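/- Let $d$ be a natural number, $\alpha\in(0,2]$, and let $\xi=(\xi_1,\dots,\xi_d)$ be a symmetric $\alpha$-stable ($S\alpha S$) random vector in $\mathbb{R}^d$, i.e. $\xi$ and $-\xi$ have the same distribution and, for all $a,b>0$, $a^{1/\alpha}\xi'+b^{1/\alpha}\xi''$ has the same distribution as $(a+b)^{1/\alpha}\xi$, where $\xi',\xi''$ are independent copies of $\xi$. The star body associated with $\xi$ is the (possibly unbounded) centred star body $F\subset\mathbb{R}^d$ with $\mathbf{E}\,e^{i\langle u,\xi\rangle}=e^{-\|u\|_F^\alpha}$ for all $u\in\mathbb{R}^d$, where $\|u\|_F=\inf\{s\ge 0: u\in sF\}$; here a centred star body is a non-empty closed set $F=-F$ with continuous $\|\cdot\|_F$ such that $[0,u)$ lies in the interior of $F$ for each $u\in F$. For a function $g$ on $\mathbb{R}^d$ put $\Delta_j g(x)=g(x)-g(x|_j)$, where $x|_j$ is $x$ with its $j$th coordinate replaced by zero, and let $\mathbf{1}_F$ be the indicator function of $F$. Let $\lambda_1,\dots,\lambda_d>0$ with $\lambda=\sum_{i=1}^d\lambda_i<\alpha$. Then $\xi$ has exactly one associated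 star body $F$, the mixed moment below is finite, and $$\mathbf{E}\big(|\xi_1|^{\lambda_1}\cdots|\xi_d|^{\lambda_d}\big)=2^{\lambda-d}\,\frac{(-1)^d}{\pi^{d/2}}\,\Gamma\Big(1-\frac{\lambda}{\alpha}\Big)\prod_{i=1}^d\frac{\lambda_i\,\Gamma(\frac{\lambda_i+1}{2})}{\Gamma(1-\frac{\lambda_i}{2})}\int_{\mathbb{R}^d}|u_1|^{-\lambda_1-1}\cdots|u_d|^{-\lambda_d-1}\,\big(\Delta_1\cdots\Delta_d\mathbf{1}_F(u)\big)\,du .$$ Here the integral over $\mathbb{R}^d$ is understood as the limit, as $\varepsilon\downarrow0$, of the (absolutely convergent) integrals over the cones $\{u: |u_i|>\varepsilon\|u\|,\ i=1,\dots,d\}$, and this limit exists. If the integrand is Lebesgue integrable over $\mathbb{R}^d$, the formula holds with the ordinary Lebesgue integral; this is the case whenever $\lambda-\lambda_k<1$ for every $k=1,\dots,d$, in particular always if $\alpha\le1$ or $d=1$. -/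

import Mathlib

open MeasureTheory ProbabilityTheory Filter Topology

/-- A random vector `ξ`, defined on the probability space `(Ω, P)`, is symmetric `α`-stable:
`ξ` and `-ξ` have the same law, and `a^{1/α} ξ₁ + b^{1/α} ξ₂` has the law of `(a+b)^{1/α} ξ` for
all `a, b > 0`, where `ξ₁, ξ₂` are independent copies of `ξ`. The copies are realised on the
product space `(Ω × Ω, P ⊗ P)` as `ξ₁ (ω₁, ω₂) = ξ ω₁` and `ξ₂ (ω₁, ω₂) = ξ ω₂`. -/
structure IsSymmetricStable {d : ℕ} {Ω : Type*} [MeasurableSpace Ω] (α : ℝ)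
    (ξ : Ω → EuclideanSpace ℝ (Fin d)) (P : Measure Ω) : Prop where
  symm : IdentDistrib (fun ω => -ξ ω) ξ P P
  stable : ∀ a b : ℝ, 0 < a → 0 < b →
    IdentDistrib (fun p : Ω × Ω => a ^ (1 / α) • ξ p.1 + b ^ (1 / α) • ξ p.2)
      (fun ω => (a + b) ^ (1 / α) • ξ ω) (P.prod P) P

/-- A (possibly unbounded) star body: a non-empty closed set `F` such that for each `u ∈ F` the
half-open segment `[0, u)` lies in the interior of `F`, and whose Minkowski functional
`‖u‖_F = inf {s > 0 : u ∈ s F}` is continuous. -/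
structure IsStarBody {d : ℕ} (F : Set (EuclideanSpace ℝ (Fin d))) : Prop where
  nonempty : F.Nonempty
  isClosed : IsClosed F
  smul_mem_interior : ∀ u ∈ F, ∀ t : ℝ, 0 ≤ t → t < 1 → t • u ∈ interior F
  continuous_gauge : Continuous (gauge F)

/-- `F` is the star body associated with the `SαS` random vector `ξ`: a centred star body such
that the characteristic function of `ξ` is `u ↦ exp (-‖u‖_F ^ α)`. -/
structure IsAssociatedStarBody {d : ℕ} {Ω : Type*} [MeasurableSpace Ω] (α : ℝ)
    (ξ : Ω → EuclideanSpace ℝ (Fin d)) (P : Measure Ω)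
    (F : Set (EuclideanSpace ℝ (Fin d))) : Prop where
  isStarBody : IsStarBody F
  neg_mem : ∀ u ∈ F, -u ∈ F
  charFun_eq : ∀ u, charFun (P.map ξ) u = ((Real.exp (-(gauge F u) ^ α) : ℝ) : ℂ)

/-- The vector `x` with its `j`-th coordinate replaced by zero. -/
noncomputable def zeroCoord {d : ℕ} (j : Fin d) (x : EuclideanSpace ℝ (Fin d)) :
    EuclideanSpace ℝ (Fin d) :=
  WithLp.toLp 2 (Function.update (fun i => x i) j 0)

/-- The operator `Δ_j`, given by `Δ_j g (x) = g (x) - g (x|_j)`. -/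
noncomputable def coordDiff {d : ℕ} (j : Fin d) (g : EuclideanSpace ℝ (Fin d) → ℝ) :
    EuclideanSpace ℝ (Fin d) → ℝ :=
  fun x => g x - g (zeroCoord j x)

/-- The composition `Δ_1 ⋯ Δ_d g`. -/
noncomputable def mixedDiff {d : ℕ} (g : EuclideanSpace ℝ (Fin d) → ℝ) :
    EuclideanSpace ℝ (Fin d) → ℝ :=
  (List.finRange d).foldr (fun j h => coordDiff j h) g

/-- The integrand `|u_1|^{-λ_1-1} ⋯ |u_d|^{-λ_d-1} (Δ_1 ⋯ Δ_d 1_F (u))`. -/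
noncomputable def mixedIntegrand {d : ℕ} (lam : Fin d → ℝ)
    (F : Set (EuclideanSpace ℝ (Fin d))) (u : EuclideanSpace ℝ (Fin d)) : ℝ :=
  (∏ i, |u i| ^ (-lam i - 1)) * mixedDiff (F.indicator fun _ => (1 : ℝ)) u

/-- The cone `{u : |u_i| > ε ‖u‖ for all i}`: what remains of the space when a conical
neighbourhood of the coordinate hyperplanes is removed. -/
def coordCone (d : ℕ) (ε : ℝ) : Set (EuclideanSpace ℝ (Fin d)) :=
  {u | ∀ i, ε * ‖u‖ < |u i|}

/-- The constant `2^{λ-d} (-1)^d π^{-d/2} Γ(1-λ/α) ∏ λ_i Γ((λ_i+1)/2) / Γ(1-λ_i/2)`, where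
`λ = λ_1 + ⋯ + λ_d`. -/
noncomputable def mixedConst {d : ℕ} (α : ℝ) (lam : Fin d → ℝ) : ℝ :=
  2 ^ ((∑ i, lam i) - d) * ((-1) ^ d / Real.pi ^ ((d : ℝ) / 2)) *
    Real.Gamma (1 - (∑ i, lam i) / α) *
    ∏ i, (lam i * Real.Gamma ((lam i + 1) / 2) / Real.Gamma (1 - lam i / 2))

/-! Everything rests on one kernel: for `0 < p < 2`, the integral over `t` of `(1 - cos (t x)) |t| ^
(-p - 1)` is `|x| ^ p` times `cosKernelConst p`. Multiplying over the coordinates and taking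
expectations, Tonelli turns the mixed moment into the integral of the weight `w(u) = ∏ |u_i| ^ (-λ_i
- 1)` against `E ∏ (1 - cos (u_i ξ_i))`.

Up to the factor `(-2) ^ d`, this expectation is the sum over all sign changes of the coordinates of
`u` of `E ∏ (exp (i u_i ξ_i) - 1)`, and the latter is `Δ_1 ⋯ Δ_d` applied to the characteristic
function `exp (-‖u‖_F ^ α)`. That function is the integral over `s > 0` of `exp (-s) 1_F (s ^ (-1/α)
u)`. Since `w` is homogeneous of degree `-λ - d`, scaling `s` out leaves the integral of `exp (-s) s
^ (-λ/α)`, which is `Γ(1 - λ/α)`, times the integral with `1_F`.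

The sum over signs is integrable on the whole space, but its single terms are in general only
controlled away from the coordinate hyperplanes. The computation therefore runs on the cones
`coordCone d ε`, which are invariant under dilations and sign changes, and dominated convergence for
the cosine integral supplies the limit.

Absolute convergence is tested radially. The kernel identity, applied to `⟨ξ, u⟩`, shows that `‖u‖_F
^ p` is a constant multiple of `E |⟨ξ, u⟩| ^ p` for `p < α`, so it is Hölder of exponent `min 1 p`
on bounded sets. Pairing each subset of coordinates with and without `k` in the mixed difference
bounds its radial integral by `C |v_k| ^ min 1 λ`, for every `k`. On a slice of a cone the weight is
bounded; on the whole space this gain offsets the weight when `λ - λ_k < 1` for all `k`.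

The star body itself exists because minus the logarithm of the characteristic function is additive
along rays in the variable `t ^ α`. -/

open scoped ENNReal

/-! ### The star body of a symmetric stable law -/

theorem IsStarBody.mem_nhds_zero {d : ℕ} {F : Set (EuclideanSpace ℝ (Fin d))} (hF : IsStarBody F) :
    F ∈ 𝓝 0 := by
  obtain ⟨u, hu⟩ := hF.nonempty
  have := hF.smul_mem_interior u hu 0 le_rfl one_pos
  rw [zero_smul] at this
  exact mem_interior_iff_mem_nhds.1 this

/-- Points of gauge less than 1 are proper multiples of points of `F`; a point of gauge 1 is a limit
of such points along its ray, and `F` is closed. -/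
theorem IsStarBody.mem_iff_gauge_le_one {d : ℕ} {F : Set (EuclideanSpace ℝ (Fin d))}
    (hF : IsStarBody F) (u : EuclideanSpace ℝ (Fin d)) : u ∈ F ↔ gauge F u ≤ 1 := by
  refine ⟨fun h => gauge_le_one_of_mem h, fun h => ?_⟩
  have habs : Absorbent ℝ F := absorbent_nhds_zero hF.mem_nhds_zero
  have hlt : ∀ v, gauge F v < 1 → v ∈ F := by
    intro v hv
    obtain ⟨r, hr0, hr1, y, hy, rfl⟩ := exists_lt_of_gauge_lt habs hv
    exact interior_subset (hF.smul_mem_interior y hy r hr0.le hr1)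
  have htend : Tendsto (fun t : ℝ => t • u) (𝓝[<] 1) (𝓝 u) := by
    have : Continuous fun t : ℝ => t • u := by fun_prop
    simpa using (this.tendsto 1).mono_left nhdsWithin_le_nhds
  refine hF.isClosed.mem_of_tendsto htend ?_
  filter_upwards [Ioo_mem_nhdsLT (zero_lt_one (α := ℝ))] with t ht
  apply hlt
  rw [gauge_smul_of_nonneg ht.1.le, smul_eq_mul]
  nlinarith [ht.1, ht.2, gauge_nonneg (s := F) u]

theorem gauge_sublevel {d : ℕ} {N : EuclideanSpace ℝ (Fin d) → ℝ} (h0 : ∀ u, 0 ≤ N u)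
    (hN : ∀ t : ℝ, 0 ≤ t → ∀ u, N (t • u) = t * N u) : gauge {u | N u ≤ 1} = N := by
  ext u
  rw [gauge_def']
  have hset : {r ∈ Set.Ioi (0 : ℝ) | r⁻¹ • u ∈ {u | N u ≤ 1}} = Set.Ioi 0 ∩ Set.Ici (N u) := by
    ext r
    simp only [Set.mem_Ioi, Set.mem_inter_iff, Set.mem_Ici, Set.mem_ofPred_eq]
    refine and_congr_right fun hr => ?_
    rw [hN _ (inv_nonneg.2 hr.le), inv_mul_le_iff₀ hr, mul_one]
  rw [hset]
  rcases (h0 u).eq_or_lt with h | h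
  · rw [← h, Set.inter_eq_left.2 Set.Ioi_subset_Ici_self, csInf_Ioi]
  · rw [Set.inter_eq_right.2 (Set.Ici_subset_Ioi.2 h), csInf_Ici]

theorem isStarBody_sublevel {d : ℕ} {N : EuclideanSpace ℝ (Fin d) → ℝ} (h0 : ∀ u, 0 ≤ N u)
    (hN : ∀ t : ℝ, 0 ≤ t → ∀ u, N (t • u) = t * N u) (hc : Continuous N) :
    IsStarBody {u | N u ≤ 1} where
  nonempty := ⟨0, by
    have := hN 0 le_rfl 0
    rw [zero_smul, zero_mul] at this
    simp [this]⟩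
  isClosed := isClosed_le hc continuous_const
  smul_mem_interior u hu t ht0 ht1 := by
    refine interior_mono (s := {u | N u < 1}) (Set.ofPred_subset_ofPred.2 fun v hv => le_of_lt hv) ?_
    rw [(isOpen_lt hc continuous_const).interior_eq]
    simp only [Set.mem_ofPred_eq] at hu ⊢
    rw [hN t ht0]
    nlinarith [h0 u]
  continuous_gauge := by rwa [gauge_sublevel h0 hN]

/-- A continuous additive function on the half-line is linear. -/
theorem eq_mul_of_additive_on_nonneg {h : ℝ → ℝ} (hc : Continuous h)
    (hadd : ∀ s t, 0 ≤ s → 0 ≤ t → h (s + t) = h s + h t) {t : ℝ} (ht : 0 ≤ t) :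
    h t = t * h 1 := by
  have h00 : h 0 = 0 := by simpa using hadd 0 0 le_rfl le_rfl
  -- The odd extension of `h`, written through positive and negative parts so that additivity is
  -- only used at nonnegative arguments.
  let H : ℝ →+ ℝ :=
    { toFun := fun t => h (max t 0) - h (max (-t) 0)
      map_zero' := by simp
      map_add' := fun s t => by
        have e : max (s + t) 0 + (max (-s) 0 + max (-t) 0)
            = max (-(s + t)) 0 + (max s 0 + max t 0) := by
          have key : ∀ x : ℝ, max x 0 = max (-x) 0 + x := fun x => by
            rcases le_total x 0 with hx | hx
            · rw [max_eq_right hx, max_eq_left (by linarith)]; ring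
            · rw [max_eq_left hx, max_eq_right (by linarith)]; ring
          rw [key (s + t), key s, key t]; ring
        have := congrArg h e
        rw [hadd (max (s + t) 0) _ (by simp) (by positivity),
          hadd (max (-s) 0) _ (by simp) (by simp),
          hadd (max (-(s + t)) 0) _ (by simp) (by positivity),
          hadd (max s 0) _ (by simp) (by simp)] at this
        linarith }
  have hH : Continuous H := by
    change Continuous fun t => h (max t 0) - h (max (-t) 0)
    fun_prop
  have := (H.toRealLinearMap hH).map_smul t 1
  simp only [AddMonoidHom.coe_toRealLinearMap, smul_eq_mul, mul_one] at this
  change h (max t 0) - h (max (-t) 0) = t * (h (max 1 0) - h (max (-1) 0)) at this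
  rw [max_eq_left ht, max_eq_right (by linarith : -t ≤ 0), max_eq_left zero_le_one,
    max_eq_right (by norm_num : (-1 : ℝ) ≤ 0), h00] at this
  linarith

namespace IsSymmetricStable

variable {d : ℕ} {Ω : Type*} [MeasurableSpace Ω] {P : Measure Ω} {α : ℝ}
  {ξ : Ω → EuclideanSpace ℝ (Fin d)}

theorem aemeasurable (hξ : IsSymmetricStable α ξ P) : AEMeasurable ξ P := hξ.symm.aemeasurable_snd

theorem charFun_neg (hξ : IsSymmetricStable α ξ P) (u : EuclideanSpace ℝ (Fin d)) :
    charFun (P.map ξ) (-u) = charFun (P.map ξ) u := by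
  conv_rhs => rw [← hξ.symm.map_eq]
  rw [charFun_apply, charFun_apply, integral_map hξ.aemeasurable (by fun_prop),
    integral_map hξ.symm.aemeasurable_fst (by fun_prop)]
  simp

theorem charFun_eq_re (hξ : IsSymmetricStable α ξ P) (u : EuclideanSpace ℝ (Fin d)) :
    charFun (P.map ξ) u = ((charFun (P.map ξ) u).re : ℝ) := by
  have h := hξ.charFun_neg u
  rw [MeasureTheory.charFun_neg] at h
  exact (Complex.conj_eq_iff_re.1 h).symm

theorem charFun_mul (hξ : IsSymmetricStable α ξ P) [IsProbabilityMeasure P] {a b : ℝ}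
    (ha : 0 < a) (hb : 0 < b) (u : EuclideanSpace ℝ (Fin d)) :
    charFun (P.map ξ) ((a + b) ^ (1 / α) • u) =
      charFun (P.map ξ) (a ^ (1 / α) • u) * charFun (P.map ξ) (b ^ (1 / α) • u) := by
  have hst := hξ.stable a b ha hb
  have h1 := congrArg (fun μ => charFun μ u) hst.map_eq
  simp only [charFun_apply] at h1
  rw [integral_map hst.aemeasurable_fst (by fun_prop),
    integral_map hst.aemeasurable_snd (by fun_prop)] at h1
  simp only [charFun_apply]
  rw [integral_map hξ.aemeasurable (by fun_prop), integral_map hξ.aemeasurable (by fun_prop),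
    integral_map hξ.aemeasurable (by fun_prop), ← integral_prod_mul]
  simp only [inner_smul_left, inner_smul_right, inner_add_left] at h1 ⊢
  simp only [RCLike.conj_to_real] at h1
  rw [← h1]
  congr 1
  ext p
  rw [← Complex.exp_add]
  push_cast
  ring_nf

theorem continuous_re_charFun (hξ : IsSymmetricStable α ξ P) [IsProbabilityMeasure P] :
    Continuous fun u => (charFun (P.map ξ) u).re := by
  have := Measure.isProbabilityMeasure_map hξ.aemeasurable
  exact Complex.continuous_re.comp continuous_charFun

theorem re_charFun_add (hξ : IsSymmetricStable α ξ P) [IsProbabilityMeasure P] (hα : 0 < α)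
    {a b : ℝ} (ha : 0 ≤ a) (hb : 0 ≤ b) (u : EuclideanSpace ℝ (Fin d)) :
    (charFun (P.map ξ) ((a + b) ^ (1 / α) • u)).re =
      (charFun (P.map ξ) (a ^ (1 / α) • u)).re * (charFun (P.map ξ) (b ^ (1 / α) • u)).re := by
  have := Measure.isProbabilityMeasure_map hξ.aemeasurable
  have hα' : 1 / α ≠ 0 := by positivity
  rcases ha.eq_or_lt with rfl | ha
  · simp [Real.zero_rpow (inv_ne_zero hα.ne')]
  rcases hb.eq_or_lt with rfl | hb
  · simp [Real.zero_rpow (inv_ne_zero hα.ne')]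
  rw [hξ.charFun_mul ha hb, hξ.charFun_eq_re (a ^ (1 / α) • u), hξ.charFun_eq_re (b ^ (1 / α) • u),
    ← Complex.ofReal_mul, Complex.ofReal_re, Complex.ofReal_re, Complex.ofReal_re]

/-- Along a ray, in the variable `t ^ (1 / α)`, the characteristic function satisfies `g t = g (t /
2) ^ 2`. A zero at `1` would propagate to all `2 ^ (-n)`, against continuity and `g 0 = 1`. -/
theorem re_charFun_pos (hξ : IsSymmetricStable α ξ P) [IsProbabilityMeasure P] (hα : 0 < α)
    (u : EuclideanSpace ℝ (Fin d)) : 0 < (charFun (P.map ξ) u).re := by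
  have := Measure.isProbabilityMeasure_map hξ.aemeasurable
  set g : ℝ → ℝ := fun t => (charFun (P.map ξ) (t ^ (1 / α) • u)).re with hg
  have hgc : Continuous g :=
    hξ.continuous_re_charFun.comp ((Real.continuous_rpow_const (by positivity)).smul continuous_const)
  have hsq : ∀ t, 0 ≤ t → g t = g (t / 2) ^ 2 := fun t ht => by
    have := hξ.re_charFun_add hα (div_nonneg ht zero_le_two) (div_nonneg ht zero_le_two) u
    rw [add_halves] at this
    rw [sq]
    exact this
  have h1 : g 1 = (charFun (P.map ξ) u).re := by simp [hg]
  have h0 : g 0 = 1 := by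
    simp [hg, Real.zero_rpow (inv_ne_zero hα.ne')]
  rw [← h1]
  refine lt_of_le_of_ne (by rw [hsq 1 zero_le_one]; positivity) fun h => ?_
  have hall : ∀ n : ℕ, g ((1 / 2 : ℝ) ^ n) = 0 := by
    intro n
    induction n with
    | zero => simpa using h.symm
    | succ n ih =>
      have := hsq ((1 / 2 : ℝ) ^ n) (by positivity)
      rw [ih] at this
      have := pow_eq_zero_iff (two_ne_zero) |>.1 this.symm
      rw [pow_succ]
      convert this using 2
      ring
  have ht := (hgc.tendsto 0).comp
    (tendsto_pow_atTop_nhds_zero_of_lt_one (r := (1 / 2 : ℝ)) (by norm_num) (by norm_num))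
  have hz : (g ∘ fun n : ℕ => (1 / 2 : ℝ) ^ n) = fun _ => 0 := funext hall
  rw [hz, h0] at ht
  exact zero_ne_one (tendsto_nhds_unique tendsto_const_nhds ht)

theorem neg_log_charFun_smul (hξ : IsSymmetricStable α ξ P) [IsProbabilityMeasure P] (hα : 0 < α)
    {t : ℝ} (ht : 0 ≤ t) (u : EuclideanSpace ℝ (Fin d)) :
    -Real.log (charFun (P.map ξ) (t • u)).re = t ^ α * -Real.log (charFun (P.map ξ) u).re := by
  have hc : Continuous fun t : ℝ => -Real.log (charFun (P.map ξ) (t ^ (1 / α) • u)).re := by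
    refine (Continuous.log ?_ fun t => (hξ.re_charFun_pos hα _).ne').neg
    exact hξ.continuous_re_charFun.comp
      ((Real.continuous_rpow_const (by positivity)).smul continuous_const)
  have := eq_mul_of_additive_on_nonneg hc (fun s t hs ht => by
    rw [hξ.re_charFun_add hα hs ht, Real.log_mul (hξ.re_charFun_pos hα _).ne'
      (hξ.re_charFun_pos hα _).ne']
    ring) (Real.rpow_nonneg ht α)
  rw [← Real.rpow_mul ht, mul_one_div_cancel hα.ne', Real.rpow_one, Real.one_rpow, one_smul] at this
  exact this

/-- With `c` minus the logarithm of the characteristic function, `c ^ (1 / α)` is continuous and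
positively homogeneous, hence the gauge of its unit sublevel set. Conversely the characteristic
function determines the gauge, and the gauge determines a star body. -/
theorem existsUnique_starBody (hξ : IsSymmetricStable α ξ P) [IsProbabilityMeasure P]
    (hα : 0 < α) : ∃! F : Set (EuclideanSpace ℝ (Fin d)), IsAssociatedStarBody α ξ P F := by
  have := Measure.isProbabilityMeasure_map hξ.aemeasurable
  set c : EuclideanSpace ℝ (Fin d) → ℝ := fun u => -Real.log (charFun (P.map ξ) u).re with hcdef
  have hc0 : ∀ u, 0 ≤ c u := fun u => by
    rw [hcdef, Left.nonneg_neg_iff]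
    refine Real.log_nonpos (hξ.re_charFun_pos hα u).le ?_
    exact (Complex.re_le_norm _).trans (norm_charFun_le_one _)
  have hcc : Continuous c :=
    (hξ.continuous_re_charFun.log fun u => (hξ.re_charFun_pos hα u).ne').neg
  set N : EuclideanSpace ℝ (Fin d) → ℝ := fun u => c u ^ (1 / α) with hN
  have hN0 : ∀ u, 0 ≤ N u := fun u => Real.rpow_nonneg (hc0 u) _
  have hNh : ∀ t : ℝ, 0 ≤ t → ∀ u, N (t • u) = t * N u := fun t ht u => by
    simp only [hN, hcdef]
    rw [hξ.neg_log_charFun_smul hα ht, Real.mul_rpow (Real.rpow_nonneg ht α) (by exact hc0 u),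
      ← Real.rpow_mul ht, mul_one_div_cancel hα.ne', Real.rpow_one]
  have hNc : Continuous N := hcc.rpow_const fun _ => Or.inr (by positivity)
  refine ⟨{u | N u ≤ 1}, ⟨isStarBody_sublevel hN0 hNh hNc, fun u hu => ?_, fun u => ?_⟩,
    fun F hF => ?_⟩
  · simpa only [hN, hcdef, Set.mem_ofPred_eq, hξ.charFun_neg] using hu
  · rw [gauge_sublevel hN0 hNh, hN, ← Real.rpow_mul (hc0 u), one_div_mul_cancel hα.ne',
      Real.rpow_one, hcdef, neg_neg, Real.exp_log (hξ.re_charFun_pos hα u)]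
    exact hξ.charFun_eq_re u
  · ext u
    rw [hF.isStarBody.mem_iff_gauge_le_one, Set.mem_ofPred_eq]
    suffices N u = gauge F u by rw [this]
    simp only [hN, hcdef]
    rw [hF.charFun_eq, Complex.ofReal_re, Real.log_exp, neg_neg, ← Real.rpow_mul (gauge_nonneg u),
      mul_one_div_cancel hα.ne', Real.rpow_one]

end IsSymmetricStable

/-! ### Mixed differences as signed sums over coordinate subsets -/

/-- The vector `x` with the coordinates in `S` replaced by zero. -/
noncomputable def zeroOn {d : ℕ} (S : Finset (Fin d)) (x : EuclideanSpace ℝ (Fin d)) :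
    EuclideanSpace ℝ (Fin d) :=
  WithLp.toLp 2 (fun i => if i ∈ S then 0 else x i)

section zeroOn

variable {d : ℕ}

@[simp]
theorem zeroOn_apply (S : Finset (Fin d)) (x : EuclideanSpace ℝ (Fin d)) (i : Fin d) :
    zeroOn S x i = if i ∈ S then 0 else x i := rfl

@[simp]
theorem zeroOn_empty (x : EuclideanSpace ℝ (Fin d)) : zeroOn ∅ x = x := by
  ext i; simp

theorem zeroOn_zeroCoord (S : Finset (Fin d)) (j : Fin d) (x : EuclideanSpace ℝ (Fin d)) :
    zeroOn S (zeroCoord j x) = zeroOn (insert j S) x := by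
  ext i
  by_cases h : i = j <;> simp [zeroCoord, h]

theorem zeroOn_smul (S : Finset (Fin d)) (c : ℝ) (x : EuclideanSpace ℝ (Fin d)) :
    zeroOn S (c • x) = c • zeroOn S x := by
  ext i; simp

theorem continuous_zeroOn (S : Finset (Fin d)) : Continuous (zeroOn S) := by
  refine (PiLp.continuous_toLp 2 _).comp (continuous_pi fun i => ?_)
  by_cases h : i ∈ S
  · simpa [h] using continuous_const
  · simp only [h, if_false]
    fun_prop

theorem norm_zeroOn_le (S : Finset (Fin d)) (x : EuclideanSpace ℝ (Fin d)) :
    ‖zeroOn S x‖ ≤ ‖x‖ := by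
  rw [EuclideanSpace.norm_eq, EuclideanSpace.norm_eq]
  refine Real.sqrt_le_sqrt (Finset.sum_le_sum fun i _ => ?_)
  by_cases h : i ∈ S <;> simp [h, sq_nonneg]

theorem inner_zeroOn (S : Finset (Fin d)) (x u : EuclideanSpace ℝ (Fin d)) :
    inner ℝ x (zeroOn S u) = ∑ i ∈ Finset.univ \ S, u i * x i := by
  rw [PiLp.inner_apply, ← Finset.sum_sdiff (Finset.subset_univ S), add_eq_left.2]
  · refine Finset.sum_congr rfl fun i hi => ?_
    simp [(Finset.mem_sdiff.1 hi).2]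
  · exact Finset.sum_eq_zero fun i hi => by simp [hi]

theorem foldr_coordDiff (g : EuclideanSpace ℝ (Fin d) → ℝ) (l : List (Fin d)) (hl : l.Nodup)
    (u : EuclideanSpace ℝ (Fin d)) :
    l.foldr (fun j h => coordDiff j h) g u =
      ∑ S ∈ l.toFinset.powerset, (-1 : ℝ) ^ S.card * g (zeroOn S u) := by
  induction l generalizing u with
  | nil => simp
  | cons j l ih =>
    have hj : j ∉ l.toFinset := by simpa using (List.nodup_cons.1 hl).1
    have ih' := ih (List.nodup_cons.1 hl).2
    rw [List.foldr_cons, coordDiff, ih', ih', List.toFinset_cons, Finset.sum_powerset_insert hj,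
      sub_eq_add_neg, ← Finset.sum_neg_distrib]
    congr 1
    refine Finset.sum_congr rfl fun S hS => ?_
    have : j ∉ S := fun h => hj (Finset.mem_powerset.1 hS h)
    rw [zeroOn_zeroCoord, Finset.card_insert_of_notMem this]
    ring

theorem mixedDiff_eq_sum (g : EuclideanSpace ℝ (Fin d) → ℝ) (u : EuclideanSpace ℝ (Fin d)) :
    mixedDiff g u = ∑ S : Finset (Fin d), (-1 : ℝ) ^ S.card * g (zeroOn S u) := by
  rw [mixedDiff, foldr_coordDiff g _ (List.nodup_finRange d), List.toFinset_finRange,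
    Finset.powerset_univ]

/-- Subsets are paired as `S` and `insert k S`, which carry opposite signs. This exposes the
cancellation in the direction `k`, for any chosen `k`. -/
theorem abs_mixedDiff_le (g : EuclideanSpace ℝ (Fin d) → ℝ) (k : Fin d)
    (u : EuclideanSpace ℝ (Fin d)) :
    |mixedDiff g u| ≤ ∑ S ∈ (Finset.univ.erase k).powerset,
      |g (zeroOn S u) - g (zeroOn (insert k S) u)| := by
  rw [mixedDiff_eq_sum, ← Finset.powerset_univ, ← Finset.insert_erase (Finset.mem_univ k),
    Finset.sum_powerset_insert (Finset.notMem_erase k _), ← Finset.sum_add_distrib,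
    Finset.insert_erase (Finset.mem_univ k)]
  refine (Finset.abs_sum_le_sum_abs _ _).trans (Finset.sum_le_sum fun S hS => ?_)
  have : k ∉ S := fun h => Finset.notMem_erase k _ (Finset.mem_powerset.1 hS h)
  rw [Finset.card_insert_of_notMem this, pow_succ]
  have e : (-1 : ℝ) ^ S.card * g (zeroOn S u) + (-1) ^ S.card * -1 * g (zeroOn (insert k S) u)
      = (-1) ^ S.card * (g (zeroOn S u) - g (zeroOn (insert k S) u)) := by ring
  rw [e, abs_mul, abs_pow, abs_neg, abs_one, one_pow, one_mul]

theorem measurable_mixedDiff {g : EuclideanSpace ℝ (Fin d) → ℝ} (hg : Measurable g) :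
    Measurable (mixedDiff g) := by
  have : mixedDiff g = fun u => ∑ S : Finset (Fin d), (-1 : ℝ) ^ S.card * g (zeroOn S u) :=
    funext (mixedDiff_eq_sum g)
  rw [this]
  exact Finset.measurable_sum _ fun S _ =>
    (hg.comp (continuous_zeroOn S).measurable).const_mul _

theorem sum_exp_inner_zeroOn (x u : EuclideanSpace ℝ (Fin d)) :
    ∑ S : Finset (Fin d), (-1 : ℂ) ^ S.card * Complex.exp ((inner ℝ x (zeroOn S u) : ℝ) * Complex.I)
      = ∏ i, (Complex.exp ((u i * x i : ℝ) * Complex.I) - 1) := by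
  rw [Finset.prod_sub, Finset.powerset_univ]
  refine Finset.sum_congr rfl fun S _ => ?_
  rw [inner_zeroOn, ← Complex.exp_sum, Finset.prod_const_one, mul_one, Complex.ofReal_sum,
    Finset.sum_mul]

end zeroOn

/-! ### One-dimensional kernel integrals -/

theorem lintegral_comp_smul {E : Type*} [NormedAddCommGroup E] [NormedSpace ℝ E]
    [MeasurableSpace E] [BorelSpace E] [FiniteDimensional ℝ E] (μ : Measure E) [μ.IsAddHaarMeasure]
    (f : E → ℝ≥0∞) {c : ℝ} (hc : c ≠ 0) :
    ∫⁻ x, f (c • x) ∂μ = ENNReal.ofReal |(c ^ Module.finrank ℝ E)⁻¹| * ∫⁻ x, f x ∂μ := by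
  have h := lintegral_map_equiv (μ := μ) f (Homeomorph.smulOfNeZero c hc).toMeasurableEquiv
  rw [← smul_eq_mul, ← lintegral_smul_measure, ← Measure.map_addHaar_smul μ hc]
  exact h.symm

theorem lintegral_abs_comp (f : ℝ → ℝ≥0∞) :
    ∫⁻ t, f |t| = 2 * ∫⁻ t in Set.Ioi 0, f t := by
  rw [← lintegral_add_compl _ measurableSet_Ioi (A := Set.Ioi (0 : ℝ)), Set.compl_Ioi,
    setLIntegral_congr Iio_ae_eq_Iic.symm, two_mul]
  have h1 : ∫⁻ t in Set.Ioi 0, f |t| = ∫⁻ t in Set.Ioi 0, f t :=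
    setLIntegral_congr_fun measurableSet_Ioi fun t ht => by
      simp only [abs_of_pos (Set.mem_Ioi.1 ht)]
  have h2 : ∫⁻ t in Set.Iio 0, f |t| = ∫⁻ t in Set.Ioi 0, f |t| := by
    have := (Measure.measurePreserving_neg (volume : Measure ℝ)).setLIntegral_comp_preimage_emb
      (MeasurableEquiv.neg ℝ).measurableEmbedding (fun t => f |t|) (Set.Ioi 0)
    simpa using this
  rw [h2, h1]

theorem lintegral_comp_mul_abs_rpow (f : ℝ → ℝ≥0∞) (p : ℝ) {c : ℝ} (hc : c ≠ 0) :
    ∫⁻ t, f (c * t) * ENNReal.ofReal (|t| ^ (-p - 1)) =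
      ENNReal.ofReal (|c| ^ p) * ∫⁻ t, f t * ENNReal.ofReal (|t| ^ (-p - 1)) := by
  have hc' : 0 < |c| := abs_pos.2 hc
  have h := lintegral_comp_smul (volume : Measure ℝ)
    (fun t => f t * ENNReal.ofReal (|t| ^ (-p - 1))) hc
  have e : ∀ t : ℝ, f (c • t) * ENNReal.ofReal (|c • t| ^ (-p - 1))
      = ENNReal.ofReal (|c| ^ (-p - 1)) * (f (c * t) * ENNReal.ofReal (|t| ^ (-p - 1))) := by
    intro t
    rw [smul_eq_mul, abs_mul, Real.mul_rpow (abs_nonneg _) (abs_nonneg _),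
      ENNReal.ofReal_mul (by positivity)]
    ring
  simp_rw [e] at h
  rw [lintegral_const_mul' _ _ ENNReal.ofReal_ne_top] at h
  have h2 := congrArg (fun x => ENNReal.ofReal (|c| ^ (p + 1)) * x) h
  simp only [← mul_assoc] at h2
  have e1 : |c| ^ (p + 1) * |c| ^ (-p - 1) = 1 := by
    rw [← Real.rpow_add hc', show p + 1 + (-p - 1) = 0 by ring, Real.rpow_zero]
  have e2 : |c| ^ (p + 1) * |c|⁻¹ = |c| ^ p := by
    rw [Real.rpow_add hc', Real.rpow_one, mul_inv_cancel_right₀ hc'.ne']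
  rw [← ENNReal.ofReal_mul (by positivity), ← ENNReal.ofReal_mul (by positivity),
    Module.finrank_self, pow_one, abs_inv, e1, e2, ENNReal.ofReal_one, one_mul] at h2
  exact h2

theorem lintegral_Ioi_exp_neg {a : ℝ} :
    ∫⁻ s in Set.Ioi a, ENNReal.ofReal (Real.exp (-s)) = ENNReal.ofReal (Real.exp (-a)) := by
  rw [← integral_exp_neg_Ioi a, ofReal_integral_eq_lintegral_ofReal (integrableOn_exp_neg_Ioi a)]
  exact Eventually.of_forall fun s => (Real.exp_pos _).le

theorem lintegral_Ioc_exp_neg {a : ℝ} (ha : 0 ≤ a) :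
    ∫⁻ s in Set.Ioc 0 a, ENNReal.ofReal (Real.exp (-s)) =
      ENNReal.ofReal (1 - Real.exp (-a)) := by
  have h := lintegral_union (μ := volume) (f := fun s => ENNReal.ofReal (Real.exp (-s)))
    (A := Set.Ioc 0 a) (B := Set.Ioi a) measurableSet_Ioi (Set.Ioc_disjoint_Ioi le_rfl)
  rw [Set.Ioc_union_Ioi_eq_Ioi ha, lintegral_Ioi_exp_neg, lintegral_Ioi_exp_neg] at h
  rw [ENNReal.ofReal_sub _ (Real.exp_pos _).le]
  rw [neg_zero, Real.exp_zero] at h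
  rw [h, ENNReal.add_sub_cancel_right ENNReal.ofReal_ne_top]

theorem lintegral_Ici_rpow {p a : ℝ} (hp : 0 < p) (ha : 0 < a) :
    ∫⁻ t in Set.Ici a, ENNReal.ofReal (t ^ (-p - 1)) = ENNReal.ofReal (a ^ (-p) / p) := by
  have hi : IntegrableOn (fun t : ℝ => t ^ (-p - 1)) (Set.Ioi a) :=
    integrableOn_Ioi_rpow_of_lt (by linarith) ha
  rw [setLIntegral_congr Ioi_ae_eq_Ici.symm, ← ofReal_integral_eq_lintegral_ofReal hi,
    integral_Ioi_rpow_of_lt (by linarith) ha]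
  · congr 1
    rw [sub_add_cancel, neg_div_neg_eq]
  · filter_upwards [ae_restrict_mem measurableSet_Ioi] with t ht
    exact Real.rpow_nonneg (ha.le.trans (le_of_lt ht)) _

theorem lintegral_exp_neg_mul_rpow_neg {q : ℝ} (hq : q < 1) :
    ∫⁻ s in Set.Ioi 0, ENNReal.ofReal (Real.exp (-s)) * ENNReal.ofReal (s ^ (-q)) =
      ENNReal.ofReal (Real.Gamma (1 - q)) := by
  have hq' : 0 < 1 - q := by linarith
  rw [Real.Gamma_eq_integral hq', ofReal_integral_eq_lintegral_ofReal
    (Real.GammaIntegral_convergent hq')]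
  · refine lintegral_congr fun s => ?_
    rw [← ENNReal.ofReal_mul (Real.exp_pos _).le]
    ring_nf
  · filter_upwards [ae_restrict_mem measurableSet_Ioi] with t ht
    have : (0 : ℝ) < t := ht
    positivity

/-- Write `1 - exp (-t ^ α)` as the integral of `exp (-s)` over `0 < s ≤ t ^ α` and integrate in `t`
first; a Gamma integral in `s` remains. -/
theorem lintegral_one_sub_exp_neg_rpow {p α : ℝ} (hp : 0 < p) (hpα : p < α) :
    ∫⁻ t : ℝ, ENNReal.ofReal (1 - Real.exp (-|t| ^ α)) * ENNReal.ofReal (|t| ^ (-p - 1)) =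
      ENNReal.ofReal (2 / p * Real.Gamma (1 - p / α)) := by
  have hα : 0 < α := hp.trans hpα
  rw [lintegral_abs_comp fun t =>
    ENNReal.ofReal (1 - Real.exp (-t ^ α)) * ENNReal.ofReal (t ^ (-p - 1))]
  have h1 : ∀ t ∈ Set.Ioi (0 : ℝ),
      ENNReal.ofReal (1 - Real.exp (-t ^ α)) * ENNReal.ofReal (t ^ (-p - 1)) =
      ∫⁻ s in Set.Ioi (0 : ℝ), (ENNReal.ofReal (Real.exp (-s)) *
        (Set.Ici (s ^ (1 / α))).indicator (fun t => ENNReal.ofReal (t ^ (-p - 1))) t) := by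
    intro t ht
    have ht : 0 < t := ht
    rw [← lintegral_Ioc_exp_neg (by positivity), ← Set.Ioi_inter_Iic, Set.inter_comm,
      ← setLIntegral_indicator measurableSet_Iic, ← lintegral_mul_const' _ _ ENNReal.ofReal_ne_top]
    refine setLIntegral_congr_fun measurableSet_Ioi fun s hs => ?_
    have hs : 0 < s := hs
    have : t ∈ Set.Ici (s ^ (1 / α)) ↔ s ∈ Set.Iic (t ^ α) := by
      rw [Set.mem_Ici, Set.mem_Iic, one_div, Real.rpow_inv_le_iff_of_pos hs.le ht.le hα]
    by_cases h : s ∈ Set.Iic (t ^ α)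
    · simp only [Set.indicator_of_mem h, Set.indicator_of_mem (this.2 h)]
    · simp only [Set.indicator_of_notMem h, Set.indicator_of_notMem (mt this.1 h), zero_mul,
        mul_zero]
  rw [setLIntegral_congr_fun measurableSet_Ioi h1, lintegral_lintegral_swap]
  · have h2 : ∀ s ∈ Set.Ioi (0 : ℝ), ∫⁻ t in Set.Ioi (0 : ℝ), (ENNReal.ofReal (Real.exp (-s)) *
        (Set.Ici (s ^ (1 / α))).indicator (fun t => ENNReal.ofReal (t ^ (-p - 1))) t) =
        ENNReal.ofReal (1 / p) *
          (ENNReal.ofReal (Real.exp (-s)) * ENNReal.ofReal (s ^ (-(p / α)))) := by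
      intro s hs
      have hs : 0 < s := hs
      rw [lintegral_const_mul' _ _ ENNReal.ofReal_ne_top, setLIntegral_indicator measurableSet_Ici,
        Set.inter_eq_left.2 (Set.Ici_subset_Ioi.2 (by positivity)),
        lintegral_Ici_rpow hp (by positivity), ← Real.rpow_mul hs.le, mul_left_comm,
        ← ENNReal.ofReal_mul (p := 1 / p) (by positivity)]
      congr 2
      rw [div_eq_inv_mul, one_div, one_div]
      congr 2
      field_simp
    rw [setLIntegral_congr_fun measurableSet_Ioi h2, lintegral_const_mul' _ _ ENNReal.ofReal_ne_top,
      lintegral_exp_neg_mul_rpow_neg ((div_lt_one hα).2 hpα), ← ENNReal.ofReal_mul (by positivity),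
      ← ENNReal.ofReal_ofNat 2, ← ENNReal.ofReal_mul (by positivity)]
    congr 1
    ring
  · refine AEMeasurable.mul (by fun_prop) ?_
    have : (Function.uncurry fun (t s : ℝ) => (Set.Ici (s ^ (1 / α))).indicator
        (fun t => ENNReal.ofReal (t ^ (-p - 1))) t) =
        {x : ℝ × ℝ | x.2 ^ (1 / α) ≤ x.1}.indicator fun x => ENNReal.ofReal (x.1 ^ (-p - 1)) := by
      ext ⟨t, s⟩
      simp [Set.indicator_apply]
    exact (this ▸ (by fun_prop : Measurable fun x : ℝ × ℝ => ENNReal.ofReal (x.1 ^ (-p - 1))).indicator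
      (measurableSet_le (by fun_prop) (by fun_prop))).aemeasurable

theorem lintegral_one_sub_exp_neg_mul_rpow {p α c : ℝ} (hp : 0 < p) (hpα : p < α) (hc : 0 ≤ c) :
    ∫⁻ t : ℝ, ENNReal.ofReal (1 - Real.exp (-(c * |t|) ^ α)) * ENNReal.ofReal (|t| ^ (-p - 1)) =
      ENNReal.ofReal (c ^ p * (2 / p * Real.Gamma (1 - p / α))) := by
  rcases hc.eq_or_lt with rfl | hc
  · simp [Real.zero_rpow hp.ne', Real.zero_rpow (hp.trans hpα).ne']
  · have := lintegral_comp_mul_abs_rpow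
      (fun t => ENNReal.ofReal (1 - Real.exp (-|t| ^ α))) p hc.ne'
    simp only [abs_mul, abs_of_pos hc] at this
    rw [this, lintegral_one_sub_exp_neg_rpow hp hpα, ENNReal.ofReal_mul (p := c ^ p) (by positivity)]

theorem lintegral_one_sub_cos_mul {p : ℝ} (hp : 0 < p) (x : ℝ) :
    ∫⁻ t : ℝ, ENNReal.ofReal (1 - Real.cos (t * x)) * ENNReal.ofReal (|t| ^ (-p - 1)) =
      ENNReal.ofReal (|x| ^ p) *
        ∫⁻ t : ℝ, ENNReal.ofReal (1 - Real.cos t) * ENNReal.ofReal (|t| ^ (-p - 1)) := by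
  rcases eq_or_ne x 0 with rfl | hx
  · simp [Real.zero_rpow hp.ne']
  · simp_rw [mul_comm _ x]
    exact lintegral_comp_mul_abs_rpow (fun t => ENNReal.ofReal (1 - Real.cos t)) p hx

/-- Tonelli for `(1 - cos (t x)) |t| ^ (-p - 1)` under `ν ⊗ dt`. It serves twice: a Gaussian `ν`
evaluates the kernel constant, and the law of `⟨ξ, u⟩` expresses the gauge through absolute moments.
-/
theorem lintegral_abs_rpow_mul_cosKernel {p α c : ℝ} (hp : 0 < p) (hpα : p < α) (hc : 0 ≤ c)
    (ν : Measure ℝ) [IsProbabilityMeasure ν]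
    (hν : ∀ t : ℝ, ∫ x, Real.cos (t * x) ∂ν = Real.exp (-(c * |t|) ^ α)) :
    (∫⁻ x, ENNReal.ofReal (|x| ^ p) ∂ν) *
        ∫⁻ t : ℝ, ENNReal.ofReal (1 - Real.cos t) * ENNReal.ofReal (|t| ^ (-p - 1)) =
      ENNReal.ofReal (c ^ p * (2 / p * Real.Gamma (1 - p / α))) := by
  rw [← lintegral_mul_const _ (by fun_prop), ← lintegral_one_sub_exp_neg_mul_rpow hp hpα hc]
  simp_rw [← lintegral_one_sub_cos_mul hp]
  rw [lintegral_lintegral_swap (by fun_prop)]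
  refine lintegral_congr fun t => ?_
  rw [lintegral_mul_const' _ _ ENNReal.ofReal_ne_top]
  congr 1
  have hi : Integrable (fun x => Real.cos (t * x)) ν :=
    Integrable.of_bound (by fun_prop) 1 (Eventually.of_forall fun x => Real.abs_cos_le_one _)
  rw [← ofReal_integral_eq_lintegral_ofReal (f := fun x => 1 - Real.cos (t * x))
    ((integrable_const 1).sub hi)
    (Eventually.of_forall fun x => by simpa using Real.cos_le_one (t * x)),
    integral_sub (integrable_const 1) hi, hν]
  simp

theorem lintegral_abs_rpow_gaussianReal {p : ℝ} (hp : 0 < p) :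
    ∫⁻ x, ENNReal.ofReal (|x| ^ p) ∂(gaussianReal 0 (1 / 2)) =
      ENNReal.ofReal (Real.Gamma ((p + 1) / 2) / √Real.pi) := by
  rw [gaussianReal_of_var_ne_zero _ (by simp), lintegral_withDensity_eq_lintegral_mul _
    (measurable_gaussianPDF _ _) (by fun_prop)]
  have e : ∀ x : ℝ, (gaussianPDF 0 (1 / 2) * fun x => ENNReal.ofReal (|x| ^ p)) x
      = ENNReal.ofReal (1 / √Real.pi) *
        ENNReal.ofReal (|x| ^ p * Real.exp (-|x| ^ (2 : ℝ))) := by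
    intro x
    rw [Pi.mul_apply, gaussianPDF, gaussianPDFReal_def,
      ← ENNReal.ofReal_mul (by positivity), ← ENNReal.ofReal_mul (by positivity)]
    congr 1
    push_cast
    rw [show 2 * Real.pi * (1 / 2) = Real.pi by ring, Real.rpow_two, sq_abs]
    simp only [sub_zero]
    rw [show -x ^ 2 / (2 * (1 / 2)) = -x ^ 2 by ring]
    ring
  simp_rw [e]
  rw [lintegral_const_mul' _ _ ENNReal.ofReal_ne_top, lintegral_abs_comp fun x =>
    ENNReal.ofReal (x ^ p * Real.exp (-x ^ (2 : ℝ))), ← ofReal_integral_eq_lintegral_ofReal,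
    integral_rpow_mul_exp_neg_rpow two_pos (by linarith), ← ENNReal.ofReal_ofNat 2,
    ← ENNReal.ofReal_mul (by positivity), ← ENNReal.ofReal_mul (by positivity)]
  · congr 1
    ring
  · exact integrableOn_rpow_mul_exp_neg_rpow (by linarith) two_pos
  · filter_upwards [ae_restrict_mem measurableSet_Ioi] with t ht
    have : (0 : ℝ) < t := ht
    positivity

/-- The value of `∫ (1 - cos t) |t| ^ (-p - 1) dt` for `0 < p < 2`. -/
noncomputable def cosKernelConst (p : ℝ) : ℝ :=
  2 ^ (1 - p) * √Real.pi * Real.Gamma (1 - p / 2) / (p * Real.Gamma ((p + 1) / 2))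

theorem cosKernelConst_pos {p : ℝ} (hp : 0 < p) (hp2 : p < 2) : 0 < cosKernelConst p := by
  have h1 := Real.Gamma_pos_of_pos (by linarith : 0 < 1 - p / 2)
  have h2 := Real.Gamma_pos_of_pos (by linarith : 0 < (p + 1) / 2)
  have := Real.pi_pos
  unfold cosKernelConst
  positivity

theorem lintegral_one_sub_cos_mul_abs_rpow {p : ℝ} (hp : 0 < p) (hp2 : p < 2) :
    ∫⁻ t : ℝ, ENNReal.ofReal (1 - Real.cos t) * ENNReal.ofReal (|t| ^ (-p - 1)) =
      ENNReal.ofReal (cosKernelConst p) := by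
  have h1 := Real.Gamma_pos_of_pos (by linarith : 0 < 1 - p / 2)
  have h2 := Real.Gamma_pos_of_pos (by linarith : 0 < (p + 1) / 2)
  -- The centred Gaussian of variance `1 / 2` has characteristic function `exp (-(|t| / 2) ^ 2)`,
  -- that is, stability index 2 and `c = 1 / 2`. Its absolute moments are explicit, so the kernel
  -- integral can be solved for.
  have h := lintegral_abs_rpow_mul_cosKernel (c := 1 / 2) hp hp2 (by norm_num)
    (gaussianReal 0 (1 / 2)) fun t => by
      have := charFun_gaussianReal (μ := 0) (v := 1 / 2) t
      have hre := congrArg Complex.re this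
      rw [charFun_apply_real, ← RCLike.re_eq_complex_re, ← integral_re] at hre
      · have e : ∀ x : ℝ, RCLike.re (Complex.exp (t * x * Complex.I)) = Real.cos (t * x) := by
          intro x
          rw [← Complex.ofReal_mul, RCLike.re_eq_complex_re, Complex.exp_ofReal_mul_I_re]
        simp_rw [e] at hre
        rw [hre, RCLike.re_eq_complex_re, Real.rpow_two, mul_pow, sq_abs, ← Complex.ofReal_re (Real.exp _)]
        congr 1
        push_cast
        congr 1
        ring
      · refine Integrable.of_bound (by fun_prop) 1 (Eventually.of_forall fun x => ?_)
        rw [← Complex.ofReal_mul, Complex.norm_exp_ofReal_mul_I]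
  have hpi : (0 : ℝ) < √Real.pi := Real.sqrt_pos.2 Real.pi_pos
  rw [lintegral_abs_rpow_gaussianReal hp] at h
  have hne : ENNReal.ofReal (Real.Gamma ((p + 1) / 2) / √Real.pi) ≠ 0 := by
    rw [Ne, ENNReal.ofReal_eq_zero, not_le]
    positivity
  rw [← ENNReal.mul_right_inj hne ENNReal.ofReal_ne_top, h, ← ENNReal.ofReal_mul (by positivity)]
  congr 1
  unfold cosKernelConst
  rw [Real.rpow_sub two_pos, Real.rpow_one, Real.div_rpow zero_le_one zero_le_two, Real.one_rpow]
  field_simp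

/-! ### Moments of stable laws and Hölder continuity of gauge powers -/

/-- The law `μ` has the characteristic function `u ↦ exp (-‖u‖_F ^ α)` for the centred star
body `F`. -/
structure HasStarBodyCharFun {d : ℕ} (α : ℝ) (μ : Measure (EuclideanSpace ℝ (Fin d)))
    (F : Set (EuclideanSpace ℝ (Fin d))) : Prop where
  isStarBody : IsStarBody F
  neg_mem : ∀ u ∈ F, -u ∈ F
  charFun_eq : ∀ u, charFun μ u = ((Real.exp (-(gauge F u) ^ α) : ℝ) : ℂ)

theorem abs_rpow_sub_rpow_le_of_le_one {p a b : ℝ} (hp : 0 < p) (hp1 : p ≤ 1) (ha : 0 ≤ a)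
    (hb : 0 ≤ b) : |a ^ p - b ^ p| ≤ |a - b| ^ p := by
  wlog h : b ≤ a generalizing a b
  · rw [abs_sub_comm, abs_sub_comm a]
    exact this hb ha (le_of_not_ge h)
  rw [abs_of_nonneg (sub_nonneg.2 (Real.rpow_le_rpow hb h hp.le)), abs_of_nonneg (sub_nonneg.2 h)]
  have := Real.rpow_add_le_add_rpow (sub_nonneg.2 h) hb hp.le hp1
  rw [sub_add_cancel] at this
  linarith

theorem abs_rpow_sub_rpow_le_of_one_le {p a b M : ℝ} (hp1 : 1 ≤ p) (ha : 0 ≤ a)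
    (hb : 0 ≤ b) (haM : a ≤ M) (hbM : b ≤ M) :
    |a ^ p - b ^ p| ≤ p * M ^ (p - 1) * |a - b| := by
  wlog h : b ≤ a generalizing a b
  · rw [abs_sub_comm, abs_sub_comm a]
    exact this hb ha hbM haM (le_of_not_ge h)
  rw [abs_of_nonneg (sub_nonneg.2 (Real.rpow_le_rpow hb h (by linarith))),
    abs_of_nonneg (sub_nonneg.2 h)]
  rcases ha.eq_or_lt with rfl | ha'
  · have : b = 0 := le_antisymm h hb
    simp [this]
  -- Bernoulli's inequality at `b / a` gives the tangent-line bound without derivatives.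
  have h1 := one_add_mul_self_le_rpow_one_add (s := b / a - 1)
    (by have : 0 ≤ b / a := by positivity
        linarith) hp1
  rw [add_sub_cancel, Real.div_rpow hb ha] at h1
  have hap : 0 < a ^ p := by positivity
  have h2 : a ^ p - b ^ p ≤ p * a ^ (p - 1) * (a - b) := by
    rw [Real.rpow_sub_one ha'.ne']
    have := mul_le_mul_of_nonneg_left h1 hap.le
    rw [mul_div_cancel₀ _ hap.ne'] at this
    have e : p * (a ^ p / a) * (a - b) = a ^ p - a ^ p * (1 + p * (b / a - 1)) := by
      field_simp
      ring
    linarith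
  refine h2.trans ?_
  have : a ^ (p - 1) ≤ M ^ (p - 1) := Real.rpow_le_rpow ha haM (by linarith)
  gcongr

/-- For `p ≤ 1` the power is Hölder with constant 1; for `p ≥ 1` it is Lipschitz on `[0, B r]`. The
constant `1 + p * B ^ (p - 1)` covers both cases. -/
theorem abs_rpow_sub_rpow_le {p a b t r B : ℝ} (hp : 0 < p) (hB : 0 < B) (ht : 0 ≤ t) (hr : 0 ≤ r)
    (haM : |a| ≤ B * r) (hbM : |b| ≤ B * r) (hab : |a - b| ≤ t * r) :
    abs (|a| ^ p - |b| ^ p) ≤ (1 + p * B ^ (p - 1)) * t ^ min 1 p * r ^ p := by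
  have hab' : abs (|a| - |b|) ≤ t * r := (abs_abs_sub_abs_le a b).trans hab
  have hBp : 0 < B ^ (p - 1) := by positivity
  rcases le_total p 1 with h1 | h1
  · rw [min_eq_right h1]
    refine (abs_rpow_sub_rpow_le_of_le_one hp h1 (abs_nonneg a) (abs_nonneg b)).trans ?_
    refine (Real.rpow_le_rpow (abs_nonneg _) hab' hp.le).trans ?_
    rw [Real.mul_rpow ht hr, mul_assoc]
    have : 0 ≤ t ^ p * r ^ p := by positivity
    nlinarith [mul_nonneg (mul_pos hp hBp).le this]
  · rw [min_eq_left h1, Real.rpow_one]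
    refine (abs_rpow_sub_rpow_le_of_one_le h1 (abs_nonneg a) (abs_nonneg b) haM hbM).trans ?_
    have h2 : p * (B * r) ^ (p - 1) * abs (|a| - |b|) ≤ p * (B * r) ^ (p - 1) * (t * r) := by
      gcongr
    refine h2.trans ?_
    have h3 : (B * r) ^ (p - 1) * r = B ^ (p - 1) * r ^ p := by
      rw [Real.mul_rpow hB.le hr, mul_assoc, ← Real.rpow_add_one' hr (by linarith), sub_add_cancel]
    have h4 : p * (B * r) ^ (p - 1) * (t * r) = p * B ^ (p - 1) * t * r ^ p := by
      linear_combination p * t * h3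
    rw [h4]
    have : 0 ≤ t * r ^ p := by positivity
    linarith

/-- The difference of the two steps is, in absolute value, the indicator of the half-open interval
between `a` and `b`. -/
theorem lintegral_rpow_mul_abs_step_sub {p a b : ℝ} (hp : 0 < p) (ha : 0 ≤ a) (hb : 0 ≤ b) :
    ∫⁻ s in Set.Ioi (0 : ℝ), ENNReal.ofReal (s ^ (p - 1)) *
      ENNReal.ofReal |(if a ≤ s then (1 : ℝ) else 0) - if b ≤ s then 1 else 0| =
      ENNReal.ofReal (|a ^ p - b ^ p| / p) := by
  wlog h : b ≤ a generalizing a b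
  · rw [abs_sub_comm (a ^ p), ← this hb ha (le_of_not_ge h)]
    simp_rw [abs_sub_comm]
  have e : ∀ s ∈ Set.Ioi (0 : ℝ), ENNReal.ofReal (s ^ (p - 1)) *
      ENNReal.ofReal |(if a ≤ s then (1 : ℝ) else 0) - if b ≤ s then 1 else 0| =
      (Set.Ico b a).indicator (fun s => ENNReal.ofReal (s ^ (p - 1))) s := by
    intro s _
    by_cases h1 : a ≤ s
    · simp [h1, h.trans h1]
    · by_cases h2 : b ≤ s <;> simp [h1, h2, not_le.1 h1]
  rw [setLIntegral_congr_fun measurableSet_Ioi e, setLIntegral_indicator measurableSet_Ico]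
  have hset : (Set.Ico b a ∩ Set.Ioi 0 : Set ℝ) =ᵐ[volume] Set.Ioc b a := by
    refine Filter.EventuallyEq.trans ?_ Ico_ae_eq_Ioc
    have : (Set.Ioi 0 : Set ℝ) =ᵐ[volume] Set.Ici 0 := Ioi_ae_eq_Ici
    have hsub : (Set.Ico b a ∩ Set.Ici 0 : Set ℝ) = Set.Ico b a :=
      Set.inter_eq_left.2 fun x hx => hb.trans hx.1
    conv_rhs => rw [← hsub]
    exact EventuallyEq.rfl.inter this
  rw [setLIntegral_congr hset, abs_of_nonneg (sub_nonneg.2 (Real.rpow_le_rpow hb h hp.le)),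
    ← ofReal_integral_eq_lintegral_ofReal, ← intervalIntegral.integral_of_le h,
    integral_rpow (Or.inl (by linarith)), sub_add_cancel]
  · exact (intervalIntegrable_iff_integrableOn_Ioc_of_le h).1
      (intervalIntegral.intervalIntegrable_rpow' (by linarith))
  · filter_upwards [ae_restrict_mem measurableSet_Ioc] with s hs
    exact Real.rpow_nonneg (hb.trans hs.1.le) _

namespace HasStarBodyCharFun

variable {d : ℕ} {α : ℝ} {μ : Measure (EuclideanSpace ℝ (Fin d))}
  {F : Set (EuclideanSpace ℝ (Fin d))}

theorem gauge_smul (h : HasStarBodyCharFun α μ F) (t : ℝ) (u : EuclideanSpace ℝ (Fin d)) :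
    gauge F (t • u) = |t| * gauge F u := by
  rcases le_total 0 t with ht | ht
  · rw [gauge_smul_of_nonneg ht, abs_of_nonneg ht, smul_eq_mul]
  · rw [← gauge_neg h.neg_mem, ← neg_smul, gauge_smul_of_nonneg (neg_nonneg.2 ht),
      abs_of_nonpos ht, smul_eq_mul]

theorem indicator_smul (h : HasStarBodyCharFun α μ F) {s : ℝ} (hs : 0 < s)
    (u : EuclideanSpace ℝ (Fin d)) :
    F.indicator (fun _ => (1 : ℝ)) (s⁻¹ • u) = if gauge F u ≤ s then 1 else 0 := by
  classical
  rw [Set.indicator_apply]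
  refine if_congr ?_ rfl rfl
  rw [h.isStarBody.mem_iff_gauge_le_one, h.gauge_smul, abs_of_pos (inv_pos.2 hs),
    inv_mul_le_iff₀ hs, mul_one]

theorem measurable_indicator (h : HasStarBodyCharFun α μ F) :
    Measurable (F.indicator fun _ => (1 : ℝ)) :=
  measurable_const.indicator h.isStarBody.isClosed.measurableSet

theorem integrable_exp_inner [IsProbabilityMeasure μ] (u : EuclideanSpace ℝ (Fin d)) :
    Integrable (fun x => Complex.exp ((inner ℝ x u : ℝ) * Complex.I)) μ :=
  Integrable.of_bound (by fun_prop) 1 (Eventually.of_forall fun x => by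
    rw [Complex.norm_exp_ofReal_mul_I])

theorem integral_cos_mul_inner (h : HasStarBodyCharFun α μ F) [IsProbabilityMeasure μ] (t : ℝ)
    (u : EuclideanSpace ℝ (Fin d)) :
    ∫ x, Real.cos (t * inner ℝ x u) ∂μ = Real.exp (-(gauge F u * |t|) ^ α) := by
  have h1 := congrArg Complex.re (h.charFun_eq (t • u))
  rw [charFun_apply, ← RCLike.re_eq_complex_re, ← integral_re (integrable_exp_inner _),
    RCLike.re_eq_complex_re, Complex.ofReal_re, h.gauge_smul, mul_comm |t|] at h1
  rw [← h1]
  refine integral_congr_ae (Eventually.of_forall fun x => ?_)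
  simp only [inner_smul_right, Complex.exp_ofReal_mul_I_re]

theorem lintegral_abs_inner_rpow (h : HasStarBodyCharFun α μ F) [IsProbabilityMeasure μ] {p : ℝ}
    (hp : 0 < p) (hpα : p < α) (hα2 : α ≤ 2) (u : EuclideanSpace ℝ (Fin d)) :
    (∫⁻ x, ENNReal.ofReal (|inner ℝ x u| ^ p) ∂μ) * ENNReal.ofReal (cosKernelConst p) =
      ENNReal.ofReal (gauge F u ^ p * (2 / p * Real.Gamma (1 - p / α))) := by
  have hm : AEMeasurable (fun x : EuclideanSpace ℝ (Fin d) => (inner ℝ x u : ℝ)) μ := by fun_prop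
  have := Measure.isProbabilityMeasure_map hm
  have := lintegral_abs_rpow_mul_cosKernel hp hpα (gauge_nonneg (s := F) u)
    (μ.map fun x => inner ℝ x u) (fun t => by
      rw [integral_map hm (by fun_prop)]
      exact h.integral_cos_mul_inner t u)
  rw [lintegral_map' (by fun_prop) hm, lintegral_one_sub_cos_mul_abs_rpow hp (by linarith)] at this
  exact this

theorem integrable_abs_inner_rpow (h : HasStarBodyCharFun α μ F) [IsProbabilityMeasure μ] {p : ℝ}
    (hp : 0 < p) (hpα : p < α) (hα2 : α ≤ 2) (u : EuclideanSpace ℝ (Fin d)) :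
    Integrable (fun x => |inner ℝ x u| ^ p) μ := by
  have h1 := h.lintegral_abs_inner_rpow hp hpα hα2 u
  have hk := cosKernelConst_pos hp (hpα.trans_le hα2)
  refine (lintegral_ofReal_ne_top_iff_integrable (by fun_prop (disch := exact hp.le))
    (Eventually.of_forall fun x => by positivity)).1 fun htop => ?_
  rw [htop, ENNReal.top_mul (by simpa using hk)] at h1
  exact ENNReal.ofReal_ne_top h1.symm

/-- The factor `c` with `‖u‖_F ^ p = c * E |⟨ξ, u⟩| ^ p`. -/
theorem exists_gauge_rpow_eq (h : HasStarBodyCharFun α μ F) [IsProbabilityMeasure μ] {p : ℝ}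
    (hp : 0 < p) (hpα : p < α) (hα2 : α ≤ 2) :
    ∃ c : ℝ, 0 < c ∧ ∀ u, gauge F u ^ p = c * ∫ x, |inner ℝ x u| ^ p ∂μ := by
  have hk := cosKernelConst_pos hp (hpα.trans_le hα2)
  have hα : 0 < α := hp.trans hpα
  have hG : 0 < Real.Gamma (1 - p / α) :=
    Real.Gamma_pos_of_pos (by rw [sub_pos, div_lt_one hα]; exact hpα)
  refine ⟨cosKernelConst p / (2 / p * Real.Gamma (1 - p / α)), by positivity, fun u => ?_⟩
  have h1 := h.lintegral_abs_inner_rpow hp hpα hα2 u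
  have h0 : 0 ≤ ∫ x, |inner ℝ x u| ^ p ∂μ := integral_nonneg fun x => by positivity
  rw [← ofReal_integral_eq_lintegral_ofReal (h.integrable_abs_inner_rpow hp hpα hα2 u)
    (Eventually.of_forall fun x => by positivity), ← ENNReal.ofReal_mul h0,
    ENNReal.ofReal_eq_ofReal_iff (by positivity)
      (mul_nonneg (Real.rpow_nonneg (gauge_nonneg u) p) (by positivity))] at h1
  rw [div_mul_eq_mul_div, eq_div_iff (by positivity), ← h1, mul_comm]

theorem norm_rpow_le_sum {p : ℝ} (hp : 0 < p) (x : EuclideanSpace ℝ (Fin d)) :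
    ‖x‖ ^ p ≤ (d : ℝ) ^ p * ∑ i, |x i| ^ p := by
  rcases isEmpty_or_nonempty (Fin d) with hd | hd
  · have : x = 0 := Subsingleton.elim _ _
    simp [this, Real.zero_rpow hp.ne']
  obtain ⟨m, -, hm⟩ := Finset.exists_max_image Finset.univ (fun i => |x i|) Finset.univ_nonempty
  have h1 : ‖x‖ ≤ d * |x m| := by
    calc ‖x‖ = ‖∑ i, EuclideanSpace.single i (x i)‖ := by
          congr 1
          ext j
          simp [Pi.single_apply]
      _ ≤ ∑ i, ‖EuclideanSpace.single i (x i)‖ := norm_sum_le _ _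
      _ ≤ ∑ i : Fin d, |x m| := Finset.sum_le_sum fun i hi => by simpa using hm i hi
      _ = d * |x m| := by simp
  calc ‖x‖ ^ p ≤ (d * |x m|) ^ p := Real.rpow_le_rpow (norm_nonneg x) h1 hp.le
    _ = (d : ℝ) ^ p * |x m| ^ p := Real.mul_rpow (by positivity) (abs_nonneg _)
    _ ≤ _ := by
        gcongr
        exact Finset.single_le_sum (f := fun i => |x i| ^ p) (fun i _ => by positivity)
          (Finset.mem_univ m)

theorem integrable_norm_rpow (h : HasStarBodyCharFun α μ F) [IsProbabilityMeasure μ] {p : ℝ}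
    (hp : 0 < p) (hpα : p < α) (hα2 : α ≤ 2) : Integrable (fun x => ‖x‖ ^ p) μ := by
  have h1 : Integrable (fun x : EuclideanSpace ℝ (Fin d) => (d : ℝ) ^ p * ∑ i, |x i| ^ p) μ := by
    refine (integrable_finsetSum _ fun i _ => ?_).const_mul _
    have := h.integrable_abs_inner_rpow hp hpα hα2 (EuclideanSpace.single i 1)
    simpa [EuclideanSpace.inner_single_right] using this
  refine h1.mono' (by fun_prop (disch := exact hp.le)) (Eventually.of_forall fun x => ?_)
  rw [Real.norm_of_nonneg (by positivity)]
  exact norm_rpow_le_sum hp x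

theorem integrable_prod_abs_rpow (h : HasStarBodyCharFun α μ F) [IsProbabilityMeasure μ]
    (hα2 : α ≤ 2) {lam : Fin d → ℝ} (hlam : ∀ i, 0 < lam i) (hsum : ∑ i, lam i < α) :
    Integrable (fun x : EuclideanSpace ℝ (Fin d) => ∏ i, |x i| ^ lam i) μ := by
  rcases isEmpty_or_nonempty (Fin d) with hd | hd
  · simp
  have hpos : 0 < ∑ i, lam i := Finset.sum_pos (fun i _ => hlam i) Finset.univ_nonempty
  refine (h.integrable_norm_rpow hpos hsum hα2).mono' ?_ (Eventually.of_forall fun x => ?_)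
  · exact (Finset.measurable_prod _ fun i _ => by fun_prop).aestronglyMeasurable
  · rw [Real.norm_of_nonneg (Finset.prod_nonneg fun i _ => by positivity),
      Real.rpow_sum_of_nonneg (norm_nonneg x) fun i _ => (hlam i).le]
    exact Finset.prod_le_prod (fun i _ => by positivity) fun i _ =>
      Real.rpow_le_rpow (abs_nonneg _) (by simpa using PiLp.norm_apply_le x i) (hlam i).le

/-- The `p`-th power of the gauge is a multiple of the mean of `|⟨x, ·⟩| ^ p`, and the two points
differ at most by `v k` along the `k`-th axis. The pointwise Hölder bound is then integrated against
`‖x‖ ^ p`, which has finite mean. -/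
theorem exists_abs_gauge_rpow_sub_le (h : HasStarBodyCharFun α μ F) [IsProbabilityMeasure μ]
    {p : ℝ} (hp : 0 < p) (hpα : p < α) (hα2 : α ≤ 2) {B : ℝ} (hB : 0 < B) :
    ∃ C : ℝ, 0 ≤ C ∧ ∀ v : EuclideanSpace ℝ (Fin d), ‖v‖ ≤ B → ∀ (k : Fin d) (S : Finset (Fin d)),
      |gauge F (zeroOn S v) ^ p - gauge F (zeroOn (insert k S) v) ^ p| ≤ C * |v k| ^ min 1 p := by
  obtain ⟨c, hc, hg⟩ := h.exists_gauge_rpow_eq hp hpα hα2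
  have hi := h.integrable_norm_rpow hp hpα hα2
  refine ⟨c * ((1 + p * B ^ (p - 1)) * ∫ x, ‖x‖ ^ p ∂μ), ?_, fun v hv k S => ?_⟩
  · have : 0 ≤ ∫ x, ‖x‖ ^ p ∂μ := integral_nonneg fun x => by positivity
    positivity
  rw [hg, hg, ← mul_sub, abs_mul, abs_of_pos hc,
    ← integral_sub (h.integrable_abs_inner_rpow hp hpα hα2 _)
      (h.integrable_abs_inner_rpow hp hpα hα2 _), mul_assoc]
  refine mul_le_mul_of_nonneg_left ?_ hc.le
  refine (abs_integral_le_integral_abs).trans ?_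
  rw [mul_right_comm, ← integral_const_mul]
  refine integral_mono_of_nonneg (Eventually.of_forall fun x => abs_nonneg _) (hi.const_mul _)
    (Eventually.of_forall fun x => ?_)
  have hin : ∀ T : Finset (Fin d), |inner ℝ x (zeroOn T v)| ≤ B * ‖x‖ := fun T =>
    (abs_real_inner_le_norm _ _).trans (by
      rw [mul_comm]
      gcongr
      exact (norm_zeroOn_le T v).trans hv)
  refine abs_rpow_sub_rpow_le hp hB (abs_nonneg _) (norm_nonneg x) (hin S) (hin _) ?_
  rw [← inner_sub_right]
  refine (abs_real_inner_le_norm _ _).trans ?_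
  rw [mul_comm]
  gcongr
  have : zeroOn S v - zeroOn (insert k S) v = EuclideanSpace.single k (if k ∈ S then 0 else v k) := by
    ext i
    by_cases hi : i = k
    · subst hi; simp
    · simp [hi]
  rw [this, EuclideanSpace.single, PiLp.norm_single]
  split_ifs <;> simp

/-- The key estimate: the radial integral of the mixed difference is small when any one coordinate
of the direction is small. Along a ray the indicator of `F` is a step function with its jump at the
gauge, so the pairing in `abs_mixedDiff_le` leaves differences of gauge powers. -/
theorem exists_lintegral_mixedDiff_le (h : HasStarBodyCharFun α μ F) [IsProbabilityMeasure μ]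
    {p : ℝ} (hp : 0 < p) (hpα : p < α) (hα2 : α ≤ 2) {B : ℝ} (hB : 0 < B) :
    ∃ C : ℝ, 0 ≤ C ∧ ∀ v : EuclideanSpace ℝ (Fin d), ‖v‖ ≤ B → ∀ k : Fin d,
      ∫⁻ s in Set.Ioi (0 : ℝ), ENNReal.ofReal (s ^ (p - 1)) *
        ENNReal.ofReal |mixedDiff (F.indicator fun _ => (1 : ℝ)) (s⁻¹ • v)| ≤
      ENNReal.ofReal (C * |v k| ^ min 1 p) := by
  obtain ⟨C, hC, hCv⟩ := h.exists_abs_gauge_rpow_sub_le hp hpα hα2 hB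
  -- `2 ^ d` bounds the number of pairs of subsets; `1 / p` comes from the radial integral.
  refine ⟨2 ^ d * (C / p), by positivity, fun v hv k => ?_⟩
  calc ∫⁻ s in Set.Ioi (0 : ℝ), ENNReal.ofReal (s ^ (p - 1)) *
        ENNReal.ofReal |mixedDiff (F.indicator fun _ => (1 : ℝ)) (s⁻¹ • v)|
      ≤ ∫⁻ s in Set.Ioi (0 : ℝ), ∑ S ∈ (Finset.univ.erase k).powerset,
        ENNReal.ofReal (s ^ (p - 1)) *
        ENNReal.ofReal |(if gauge F (zeroOn S v) ≤ s then (1 : ℝ) else 0) -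
          if gauge F (zeroOn (insert k S) v) ≤ s then 1 else 0| := by
        refine setLIntegral_mono' measurableSet_Ioi fun s hs => ?_
        rw [← Finset.mul_sum, ← ENNReal.ofReal_sum_of_nonneg fun _ _ => abs_nonneg _]
        gcongr
        refine (abs_mixedDiff_le _ k _).trans_eq (Finset.sum_congr rfl fun S _ => ?_)
        rw [zeroOn_smul, zeroOn_smul, h.indicator_smul hs, h.indicator_smul hs]
    _ = ∑ S ∈ (Finset.univ.erase k).powerset, ENNReal.ofReal
        (|gauge F (zeroOn S v) ^ p - gauge F (zeroOn (insert k S) v) ^ p| / p) := by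
        rw [lintegral_finsetSum' _ fun S _ => ?_]
        · exact Finset.sum_congr rfl fun S _ =>
            lintegral_rpow_mul_abs_step_sub hp (gauge_nonneg _) (gauge_nonneg _)
        · have h1 : ∀ a : ℝ, Measurable fun s : ℝ => if a ≤ s then (1 : ℝ) else 0 := fun a =>
            Measurable.ite measurableSet_Ici measurable_const measurable_const
          have := h1 (gauge F (zeroOn S v))
          have := h1 (gauge F (zeroOn (insert k S) v))
          fun_prop
    _ ≤ ∑ S ∈ (Finset.univ.erase k).powerset, ENNReal.ofReal (C / p * |v k| ^ min 1 p) := by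
        refine Finset.sum_le_sum fun S _ => ENNReal.ofReal_le_ofReal ?_
        rw [div_mul_eq_mul_div]
        exact div_le_div_of_nonneg_right (hCv v hv k S) hp.le
    _ ≤ ∑ S : Finset (Fin d), ENNReal.ofReal (C / p * |v k| ^ min 1 p) :=
        Finset.sum_le_sum_of_subset (Finset.subset_univ _)
    _ = _ := by
        rw [Finset.sum_const, Finset.card_univ, Fintype.card_finset, Fintype.card_fin, nsmul_eq_mul,
          mul_assoc, ENNReal.ofReal_mul (p := 2 ^ d) (by positivity)]
        simp

end HasStarBodyCharFun

/-! ### Polar integration and integrability of the mixed integrand -/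

theorem lintegral_Ioi_inv_mul_indicator {a : ℝ} (ha : 0 < a) :
    ∫⁻ s in Set.Ioi (0 : ℝ), ENNReal.ofReal s⁻¹ *
      (if 1 ≤ s * a ∧ s * a < 2 then (1 : ℝ≥0∞) else 0) = ENNReal.ofReal (Real.log 2) := by
  have e : ∀ s ∈ Set.Ioi (0 : ℝ), ENNReal.ofReal s⁻¹ *
      (if 1 ≤ s * a ∧ s * a < 2 then (1 : ℝ≥0∞) else 0) =
      (Set.Ico (1 / a) (2 / a)).indicator (fun s => ENNReal.ofReal s⁻¹) s := by
    intro s _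
    have : (1 ≤ s * a ∧ s * a < 2) ↔ s ∈ Set.Ico (1 / a) (2 / a) := by
      rw [Set.mem_Ico, div_le_iff₀ ha, lt_div_iff₀ ha]
    by_cases h : s ∈ Set.Ico (1 / a) (2 / a)
    · rw [if_pos (this.2 h), Set.indicator_of_mem h, mul_one]
    · rw [if_neg (mt this.1 h), Set.indicator_of_notMem h, mul_zero]
  have h1 : 0 < 1 / a := by positivity
  have h12 : 1 / a ≤ 2 / a := by gcongr; norm_num
  rw [setLIntegral_congr_fun measurableSet_Ioi e, setLIntegral_indicator measurableSet_Ico,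
    Set.inter_eq_left.2 (show Set.Ico (1 / a) (2 / a) ⊆ Set.Ioi 0 from fun s hs => h1.trans_le hs.1), setLIntegral_congr Ico_ae_eq_Ioc,
    ← ofReal_integral_eq_lintegral_ofReal, ← intervalIntegral.integral_of_le h12,
    integral_inv_of_pos h1 (h1.trans_le h12)]
  · congr 2
    field_simp
  · refine (intervalIntegrable_iff_integrableOn_Ioc_of_le h12).1 ?_
    refine intervalIntegral.intervalIntegrable_inv (fun x hx => ?_) continuousOn_id
    rw [Set.uIcc_of_le h12] at hx
    exact (h1.trans_le hx.1).ne'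
  · filter_upwards [ae_restrict_mem measurableSet_Ioc] with s hs
    exact (inv_pos.2 (h1.trans hs.1)).le

/-- Integration in polar coordinates with respect to a homogeneous function `N`, the radial
integral being applied to the factor `A`. -/
theorem log_two_mul_lintegral_homogeneous {d : ℕ} {p : ℝ}
    {N : EuclideanSpace ℝ (Fin d) → ℝ} (hNm : Measurable N)
    (hN : ∀ s : ℝ, 0 < s → ∀ u, N (s • u) = s * N u)
    {w : EuclideanSpace ℝ (Fin d) → ℝ≥0∞} (hwm : Measurable w)
    (hw : ∀ s : ℝ, 0 < s → ∀ u, w (s • u) = ENNReal.ofReal (s ^ (-p - d)) * w u)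
    (hNw : ∀ u, w u ≠ 0 → 0 < N u)
    {A : EuclideanSpace ℝ (Fin d) → ℝ≥0∞} (hAm : Measurable A) :
    ENNReal.ofReal (Real.log 2) * ∫⁻ u, w u * A u =
      ∫⁻ v, (if 1 ≤ N v ∧ N v < 2 then w v else 0) *
        ∫⁻ s in Set.Ioi (0 : ℝ), ENNReal.ofReal (s ^ (p - 1)) * A (s⁻¹ • v) := by
  have hT : Measurable fun v => if 1 ≤ N v ∧ N v < 2 then (1 : ℝ≥0∞) else 0 :=
    Measurable.ite ((measurableSet_le measurable_const hNm).inter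
      (measurableSet_lt hNm measurable_const)) measurable_const measurable_const
  set T : EuclideanSpace ℝ (Fin d) → ℝ≥0∞ := fun v => if 1 ≤ N v ∧ N v < 2 then 1 else 0 with hTdef
  -- The factor `log 2` is the `ds / s`-measure of the `s` with `1 ≤ N (s • u) < 2`, the same for
  -- every `u` in the support of `w`. Exchanging the integrals and substituting `v = s • u` then
  -- needs no surface measure.
  have hl : ENNReal.ofReal (Real.log 2) * ∫⁻ u, w u * A u =
      ∫⁻ u, ∫⁻ s in Set.Ioi (0 : ℝ), ENNReal.ofReal s⁻¹ * (T (s • u) * (w u * A u)) := by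
    rw [← lintegral_const_mul' _ _ ENNReal.ofReal_ne_top]
    refine lintegral_congr fun u => ?_
    by_cases hu : w u = 0
    · simp [hu]
    · have hm : Measurable fun s : ℝ => ENNReal.ofReal s⁻¹ *
          (if 1 ≤ s * N u ∧ s * N u < 2 then (1 : ℝ≥0∞) else 0) := by
        refine Measurable.mul (by fun_prop) (Measurable.ite ?_ measurable_const measurable_const)
        exact (measurableSet_le measurable_const (measurable_id.mul_const _)).inter
          (measurableSet_lt (measurable_id.mul_const _) measurable_const)
      rw [← lintegral_Ioi_inv_mul_indicator (hNw u hu), ← lintegral_mul_const _ hm]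
      refine setLIntegral_congr_fun measurableSet_Ioi fun s hs => ?_
      simp only [hTdef, hN s hs, mul_assoc]
  have hr : ∫⁻ v, (if 1 ≤ N v ∧ N v < 2 then w v else 0) *
        ∫⁻ s in Set.Ioi (0 : ℝ), ENNReal.ofReal (s ^ (p - 1)) * A (s⁻¹ • v) =
      ∫⁻ v, ∫⁻ s in Set.Ioi (0 : ℝ),
        ENNReal.ofReal (s ^ (p - 1)) * (T v * w v * A (s⁻¹ • v)) := by
    refine lintegral_congr fun v => ?_
    rw [← lintegral_const_mul _ (by fun_prop)]
    refine lintegral_congr fun s => ?_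
    by_cases hv : 1 ≤ N v ∧ N v < 2
    · simp only [hTdef, if_pos hv, one_mul]; ring
    · simp only [hTdef, if_neg hv, zero_mul, mul_zero]
  rw [hl, hr]
  refine (lintegral_lintegral_swap (by fun_prop)).trans
    (Eq.trans ?_ (lintegral_lintegral_swap (by fun_prop)).symm)
  refine setLIntegral_congr_fun measurableSet_Ioi fun s hs => ?_
  have hs : 0 < s := hs
  rw [lintegral_const_mul' _ _ ENNReal.ofReal_ne_top, lintegral_const_mul' _ _ ENNReal.ofReal_ne_top]
  have h := lintegral_comp_smul (volume : Measure (EuclideanSpace ℝ (Fin d)))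
    (fun v => T v * w v * A (s⁻¹ • v)) hs.ne'
  simp only [inv_smul_smul₀ hs.ne', hw s hs] at h
  have e : ∀ u, T (s • u) * (ENNReal.ofReal (s ^ (-p - d)) * w u) * A u =
      ENNReal.ofReal (s ^ (-p - d)) * (T (s • u) * (w u * A u)) := fun u => by ring
  simp_rw [e] at h
  rw [lintegral_const_mul' _ _ ENNReal.ofReal_ne_top, finrank_euclideanSpace_fin] at h
  -- This power turns the homogeneity factor `s ^ (-p - d)` into `s⁻¹` and the Jacobian `s ^ (-d)`
  -- into `s ^ (p - 1)`.
  have h2 := congrArg (fun x => ENNReal.ofReal (s ^ (p + d - 1)) * x) h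
  simp only [← mul_assoc] at h2
  have e1 : s ^ (p + d - 1) * s ^ (-p - d) = s⁻¹ := by
    rw [← Real.rpow_add hs, show p + d - 1 + (-p - d) = -1 by ring, Real.rpow_neg_one]
  have e2 : s ^ (p + d - 1) * |(s ^ d)⁻¹| = s ^ (p - 1) := by
    rw [abs_of_pos (by positivity), ← Real.rpow_natCast, ← Real.rpow_neg hs.le, ← Real.rpow_add hs]
    congr 1
    ring
  rw [← ENNReal.ofReal_mul (by positivity), ← ENNReal.ofReal_mul (by positivity), e1, e2] at h2
  simpa only [mul_assoc] using h2

/-- The weight `|u_1|^{-λ_1-1} ⋯ |u_d|^{-λ_d-1}`. -/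
noncomputable def coordWeight {d : ℕ} (lam : Fin d → ℝ) (u : EuclideanSpace ℝ (Fin d)) : ℝ :=
  ∏ i, |u i| ^ (-lam i - 1)

section coordWeight

variable {d : ℕ} {lam : Fin d → ℝ}

theorem coordWeight_nonneg (u : EuclideanSpace ℝ (Fin d)) : 0 ≤ coordWeight lam u :=
  Finset.prod_nonneg fun _ _ => by positivity

theorem measurable_coordWeight : Measurable (coordWeight lam) :=
  Finset.measurable_prod _ fun i _ => by fun_prop

theorem coordWeight_smul {s : ℝ} (hs : 0 < s) (u : EuclideanSpace ℝ (Fin d)) :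
    coordWeight lam (s • u) = s ^ (-(∑ i, lam i) - d) * coordWeight lam u := by
  have : -(∑ i, lam i) - (d : ℝ) = ∑ i, (-lam i - 1) := by simp [Finset.sum_neg_distrib]
  rw [this, Real.rpow_sum_of_pos hs, coordWeight, coordWeight, ← Finset.prod_mul_distrib]
  refine Finset.prod_congr rfl fun i _ => ?_
  rw [PiLp.smul_apply, smul_eq_mul, abs_mul, abs_of_pos hs,
    Real.mul_rpow hs.le (abs_nonneg _)]

/-- The convention `0 ^ y = 0` for `y ≠ 0` makes the weight vanish, rather than blow up, on the
coordinate hyperplanes. -/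
theorem apply_ne_zero_of_coordWeight_ne_zero (hlam : ∀ i, 0 < lam i)
    {u : EuclideanSpace ℝ (Fin d)} (hu : coordWeight lam u ≠ 0) (i : Fin d) : u i ≠ 0 := by
  intro h
  refine hu (Finset.prod_eq_zero (Finset.mem_univ i) ?_)
  rw [h, abs_zero, Real.zero_rpow]
  linarith [hlam i]

theorem mixedIntegrand_eq (F : Set (EuclideanSpace ℝ (Fin d))) (u : EuclideanSpace ℝ (Fin d)) :
    mixedIntegrand lam F u = coordWeight lam u * mixedDiff (F.indicator fun _ => (1 : ℝ)) u := rfl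

theorem measurableSet_coordCone (ε : ℝ) : MeasurableSet (coordCone d ε) := by
  have : coordCone d ε = ⋂ i, {u : EuclideanSpace ℝ (Fin d) | ε * ‖u‖ < |u i|} := by
    ext u; simp [coordCone]
  rw [this]
  exact MeasurableSet.iInter fun i => measurableSet_lt (by fun_prop) (by fun_prop)

theorem smul_mem_coordCone_iff {s ε : ℝ} (hs : 0 < s) (u : EuclideanSpace ℝ (Fin d)) :
    s • u ∈ coordCone d ε ↔ u ∈ coordCone d ε := by
  refine forall_congr' fun i => ?_
  rw [norm_smul, PiLp.smul_apply, smul_eq_mul, abs_mul, Real.norm_eq_abs, abs_of_pos hs,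
    mul_left_comm, mul_lt_mul_iff_right₀ hs]

end coordWeight

namespace HasStarBodyCharFun

variable {d : ℕ} {α : ℝ} {μ : Measure (EuclideanSpace ℝ (Fin d))}
  {F : Set (EuclideanSpace ℝ (Fin d))} {lam : Fin d → ℝ}

theorem measurable_mixedIntegrand (h : HasStarBodyCharFun α μ F) :
    Measurable (mixedIntegrand lam F) :=
  measurable_coordWeight.mul (measurable_mixedDiff h.measurable_indicator)

/-- Integrability of the mixed integrand on a cone follows from that of the radially integrated
integrand on a slice `1 ≤ N < 2` of it. -/
theorem integrableOn_mixedIntegrand (h : HasStarBodyCharFun α μ F)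
    {R : Set (EuclideanSpace ℝ (Fin d))} (hRm : MeasurableSet R)
    (hR : ∀ s : ℝ, 0 < s → ∀ u, s • u ∈ R ↔ u ∈ R)
    {N : EuclideanSpace ℝ (Fin d) → ℝ} (hNm : Measurable N)
    (hN : ∀ s : ℝ, 0 < s → ∀ u, N (s • u) = s * N u)
    (hNw : ∀ u, coordWeight lam u ≠ 0 → 0 < N u)
    {g : EuclideanSpace ℝ (Fin d) → ℝ} (hg : Integrable g)
    (hle : ∀ v ∈ R, 1 ≤ N v → N v < 2 → ENNReal.ofReal (coordWeight lam v) *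
      ∫⁻ s in Set.Ioi (0 : ℝ), ENNReal.ofReal (s ^ ((∑ i, lam i) - 1)) *
        ENNReal.ofReal |mixedDiff (F.indicator fun _ => (1 : ℝ)) (s⁻¹ • v)| ≤
      ENNReal.ofReal (g v)) :
    IntegrableOn (mixedIntegrand lam F) R := by
  refine ⟨h.measurable_mixedIntegrand.aestronglyMeasurable, ?_⟩
  have hA : Measurable fun u => ENNReal.ofReal |mixedDiff (F.indicator fun _ => (1 : ℝ)) u| :=
    ((measurable_mixedDiff h.measurable_indicator).abs).ennreal_ofReal
  have key := log_two_mul_lintegral_homogeneous (p := ∑ i, lam i) hNm hN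
    (w := R.indicator fun u => ENNReal.ofReal (coordWeight lam u))
    (measurable_coordWeight.ennreal_ofReal.indicator hRm) (fun s hs u => by
      by_cases hu : u ∈ R
      · rw [Set.indicator_of_mem hu, Set.indicator_of_mem ((hR s hs u).2 hu), coordWeight_smul hs,
          ENNReal.ofReal_mul (by positivity)]
      · rw [Set.indicator_of_notMem hu, Set.indicator_of_notMem (mt (hR s hs u).1 hu), mul_zero])
    (fun u hu => by
      refine hNw u fun h0 => hu ?_
      simp [h0]) hA
  have hlog : ENNReal.ofReal (Real.log 2) ≠ 0 := by
    simpa using Real.log_pos one_lt_two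
  have hfin : ∫⁻ u, (R.indicator fun u => ENNReal.ofReal (coordWeight lam u)) u *
      ENNReal.ofReal |mixedDiff (F.indicator fun _ => (1 : ℝ)) u| < ∞ := by
    refine lt_top_iff_ne_top.2 fun htop => ?_
    rw [htop, ENNReal.mul_top hlog] at key
    refine absurd key.symm (ne_of_lt (lt_of_le_of_lt (lintegral_mono fun v => ?_)
      (hg.lintegral_lt_top)))
    by_cases hv : 1 ≤ N v ∧ N v < 2
    · rw [if_pos hv]
      by_cases hvR : v ∈ R
      · rw [Set.indicator_of_mem hvR]
        exact hle v hvR hv.1 hv.2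
      · rw [Set.indicator_of_notMem hvR, zero_mul]
        exact zero_le
    · rw [if_neg hv, zero_mul]
      exact zero_le
  rw [hasFiniteIntegral_iff_norm, ← lintegral_indicator hRm]
  refine lt_of_le_of_lt (lintegral_mono fun u => ?_) hfin
  by_cases hu : u ∈ R
  · rw [Set.indicator_of_mem hu, Set.indicator_of_mem hu, mixedIntegrand_eq, norm_mul,
      Real.norm_of_nonneg (coordWeight_nonneg u), ENNReal.ofReal_mul (coordWeight_nonneg u),
      Real.norm_eq_abs]
  · rw [Set.indicator_of_notMem hu]
    exact zero_le

/-- On the slice `1 ≤ ‖v‖ < 2` of the cone every `|v i|` exceeds `ε`, so the weight is bounded and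
so is the radial integral. -/
theorem integrableOn_coordCone (h : HasStarBodyCharFun α μ F) [IsProbabilityMeasure μ]
    (hα2 : α ≤ 2) (hlam : ∀ i, 0 < lam i) (hsum : ∑ i, lam i < α) {ε : ℝ} (hε : 0 < ε) :
    IntegrableOn (mixedIntegrand lam F) (coordCone d ε) := by
  rcases isEmpty_or_nonempty (Fin d) with hd | ⟨⟨k⟩⟩
  · have hc : mixedIntegrand lam F = fun _ => mixedIntegrand lam F 0 :=
      funext fun u => congrArg _ (Subsingleton.elim _ _)
    rw [hc]
    refine integrableOn_const ((measure_mono (Set.subset_univ _)).trans_lt ?_).ne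
    exact (Set.toFinite (Set.univ : Set (EuclideanSpace ℝ (Fin d)))).isCompact.measure_lt_top
  have hpos : 0 < ∑ i, lam i := Finset.sum_pos (fun i _ => hlam i) ⟨k, Finset.mem_univ k⟩
  obtain ⟨C, hC, hCv⟩ := h.exists_lintegral_mixedDiff_le hpos hsum hα2 (two_pos (α := ℝ))
  set β := min 1 (∑ i, lam i) with hβ
  have hβ0 : 0 ≤ β := le_min zero_le_one hpos.le
  refine h.integrableOn_mixedIntegrand (measurableSet_coordCone ε)
    (fun s hs u => smul_mem_coordCone_iff hs u) measurable_norm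
    (fun s hs u => by rw [norm_smul, Real.norm_of_nonneg hs.le])
    (fun u hu => norm_pos_iff.2 fun h0 =>
      apply_ne_zero_of_coordWeight_ne_zero hlam hu k (by simp [h0]))
    (g := (Metric.closedBall 0 2).indicator fun _ => (∏ i, ε ^ (-lam i - 1)) * (C * 2 ^ β))
    ((integrable_indicator_iff measurableSet_closedBall).2
      (integrableOn_const measure_closedBall_lt_top.ne)) fun v hv h1 h2 => ?_
  rw [Set.indicator_of_mem (by simpa using h2.le),
    ENNReal.ofReal_mul (Finset.prod_nonneg fun _ _ => by positivity)]
  refine mul_le_mul' (ENNReal.ofReal_le_ofReal ?_) ((hCv v h2.le k).trans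
    (ENNReal.ofReal_le_ofReal ?_))
  · refine Finset.prod_le_prod (fun _ _ => by positivity) fun i _ => ?_
    have : ε ≤ |v i| := (le_mul_of_one_le_right hε.le h1).trans (hv i).le
    exact Real.rpow_le_rpow_of_nonpos hε this (by linarith [hlam i])
  · have : |v k| ≤ 2 := (by simpa using PiLp.norm_apply_le v k : |v k| ≤ ‖v‖).trans h2.le
    gcongr

theorem integrable_ite_abs_rpow {a : ℝ} (ha : -1 < a) :
    Integrable fun x : ℝ => if |x| ≤ 2 then |x| ^ a else 0 := by
  have hm : Measurable fun x : ℝ => if |x| ≤ 2 then |x| ^ a else 0 :=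
    Measurable.ite (measurableSet_le (by fun_prop) (by fun_prop)) (by fun_prop) measurable_const
  refine (lintegral_ofReal_ne_top_iff_integrable hm.aestronglyMeasurable
    (Eventually.of_forall fun x => by simp only [Pi.zero_apply]; positivity)).1 ?_
  rw [lintegral_abs_comp fun x => ENNReal.ofReal (if x ≤ 2 then x ^ a else 0)]
  refine ENNReal.mul_ne_top ENNReal.ofNat_ne_top ?_
  have e : ∀ x : ℝ, ENNReal.ofReal (if x ≤ 2 then x ^ a else 0) =
      (Set.Iic 2).indicator (fun x => ENNReal.ofReal (x ^ a)) x := fun x => by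
    by_cases hx : x ≤ 2 <;> simp [hx]
  simp_rw [e]
  rw [setLIntegral_indicator measurableSet_Iic, Set.inter_comm, Set.Ioi_inter_Iic]
  have := (intervalIntegrable_iff_integrableOn_Ioc_of_le (zero_le_two (α := ℝ))).1
    (intervalIntegral.intervalIntegrable_rpow' ha)
  exact (Integrable.lintegral_lt_top this).ne

/-- Take `k` minimising `|v k|` over `k ≠ m` and split the exponent `β` in proportion to the `lam
i`: the single inequality `∑_{j ≠ m} lam j < β` then makes each share exceed its `lam i`. The factor
`2 ^ β` is needed only when `m` is the sole coordinate. -/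
theorem exists_abs_rpow_le_prod (hlam : ∀ i, 0 < lam i) (m : Fin d) {β : ℝ} (hβ : 0 ≤ β)
    (v : EuclideanSpace ℝ (Fin d)) (hv : |v m| ≤ 2) :
    ∃ k, |v k| ^ β ≤ 2 ^ β *
      ∏ i ∈ Finset.univ.erase m, |v i| ^ (β * lam i / ∑ j ∈ Finset.univ.erase m, lam j) := by
  rcases (Finset.univ.erase m).eq_empty_or_nonempty with h | h
  · refine ⟨m, ?_⟩
    rw [h, Finset.prod_empty, mul_one]
    exact Real.rpow_le_rpow (abs_nonneg _) hv hβ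
  · obtain ⟨k, -, hk⟩ := Finset.exists_min_image _ (fun i => |v i|) h
    have hΛ : 0 < ∑ j ∈ Finset.univ.erase m, lam j := Finset.sum_pos (fun i _ => hlam i) h
    refine ⟨k, ?_⟩
    have h1 : |v k| ^ β = ∏ i ∈ Finset.univ.erase m,
        |v k| ^ (β * lam i / ∑ j ∈ Finset.univ.erase m, lam j) := by
      rw [← Real.rpow_sum_of_nonneg (abs_nonneg _) fun i _ =>
        div_nonneg (mul_nonneg hβ (hlam i).le) hΛ.le, ← Finset.sum_div, ← Finset.mul_sum,
        mul_div_cancel_right₀ _ hΛ.ne']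
    have h2 : |v k| ^ β ≤ ∏ i ∈ Finset.univ.erase m,
        |v i| ^ (β * lam i / ∑ j ∈ Finset.univ.erase m, lam j) := by
      rw [h1]
      exact Finset.prod_le_prod (fun _ _ => by positivity) fun i hi =>
        Real.rpow_le_rpow (abs_nonneg _) (hk i hi) (div_nonneg (mul_nonneg hβ (hlam i).le) hΛ.le)
    exact h2.trans (le_mul_of_one_le_left (Finset.prod_nonneg fun _ _ => by positivity)
      (Real.one_le_rpow one_le_two hβ))

/-- The space is cut into the sectors where `|u m|` is the largest coordinate, each sliced at `1 ≤
|v m| < 2`. There the singular factors belong to the other coordinates, and the gain `|v k| ^ β`,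
shared among them, raises every exponent above `-1`. -/
theorem integrable_mixedIntegrand (h : HasStarBodyCharFun α μ F) [IsProbabilityMeasure μ]
    (hα2 : α ≤ 2) (hlam : ∀ i, 0 < lam i) (hsum : ∑ i, lam i < α)
    (hk : ∀ k, (∑ i, lam i) - lam k < 1) : Integrable (mixedIntegrand lam F) := by
  rcases isEmpty_or_nonempty (Fin d) with hd | hd
  · rw [← integrableOn_univ]
    convert h.integrableOn_coordCone hα2 hlam hsum one_pos
    exact (Set.eq_univ_of_forall fun u i => hd.elim i).symm
  have hpos : 0 < ∑ i, lam i := Finset.sum_pos (fun i _ => hlam i) Finset.univ_nonempty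
  set R : Fin d → Set (EuclideanSpace ℝ (Fin d)) := fun m => {u | ∀ k, |u k| ≤ |u m|} with hRdef
  have hU : ⋃ m, R m = Set.univ := by
    refine Set.eq_univ_of_forall fun u => ?_
    obtain ⟨m, -, hm⟩ := Finset.exists_max_image Finset.univ (fun i => |u i|) Finset.univ_nonempty
    exact Set.mem_iUnion.2 ⟨m, fun k => hm k (Finset.mem_univ k)⟩
  rw [← integrableOn_univ, ← hU, integrableOn_finite_iUnion]
  intro m
  have hRm : MeasurableSet (R m) := by
    have : R m = ⋂ k, {u : EuclideanSpace ℝ (Fin d) | |u k| ≤ |u m|} := by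
      ext u; simp [hRdef]
    rw [this]
    exact MeasurableSet.iInter fun k => measurableSet_le (by fun_prop) (by fun_prop)
  set β := min 1 (∑ i, lam i) with hβ
  have hβ0 : 0 ≤ β := le_min zero_le_one hpos.le
  have hΛ : ∑ j ∈ Finset.univ.erase m, lam j = (∑ i, lam i) - lam m := by
    rw [← Finset.sum_erase_add _ _ (Finset.mem_univ m), add_sub_cancel_right]
  have hΛβ : ∑ j ∈ Finset.univ.erase m, lam j < β := by
    rw [hΛ]
    exact lt_min (hk m) (by linarith [hlam m])
  set γ : Fin d → ℝ := fun i => β * lam i / ∑ j ∈ Finset.univ.erase m, lam j with hγ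
  have hγlam : ∀ i ≠ m, lam i < γ i := fun i hi => by
    have h0 : 0 < ∑ j ∈ Finset.univ.erase m, lam j :=
      Finset.sum_pos (fun i _ => hlam i) ⟨i, by simp [hi]⟩
    simp only [hγ]
    rw [lt_div_iff₀ h0, mul_comm]
    exact mul_lt_mul_of_pos_right hΛβ (hlam i)
  set a : Fin d → ℝ := fun i => if i = m then 0 else γ i - lam i - 1 with ha
  have ha1 : ∀ i, -1 < a i := fun i => by
    by_cases hi : i = m
    · simp [ha, hi]
    · simp only [ha, if_neg hi]
      linarith [hγlam i hi]
  -- All coordinates are at most 2 on the slice, so `‖v‖ ≤ d * (d * 2)`; the added 1 only gives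
  -- positivity.
  have hB : (0 : ℝ) < d * (d * 2) + 1 := by positivity
  obtain ⟨C, hC, hCv⟩ := h.exists_lintegral_mixedDiff_le hpos hsum hα2 hB
  refine h.integrableOn_mixedIntegrand hRm (fun s hs u => ?_) (N := fun u => |u m|) (by fun_prop)
    (fun s hs u => ?_) (fun u hu => ?_)
    (g := fun v => C * 2 ^ β * ∏ i, if |v i| ≤ 2 then |v i| ^ a i else 0) ?_
    (fun v hv h1 h2 => ?_)
  · refine forall_congr' fun k => ?_
    rw [PiLp.smul_apply, PiLp.smul_apply, smul_eq_mul, smul_eq_mul, abs_mul, abs_mul,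
      abs_of_pos hs, mul_le_mul_iff_right₀ hs]
  · simp only [PiLp.smul_apply, smul_eq_mul, abs_mul, abs_of_pos hs]
  · exact abs_pos.2 (apply_ne_zero_of_coordWeight_ne_zero hlam hu m)
  · have := Integrable.fintype_prod (μ := fun _ : Fin d => (volume : Measure ℝ))
      fun i => integrable_ite_abs_rpow (ha1 i)
    refine Integrable.const_mul ?_ _
    exact ((PiLp.volume_preserving_ofLp (Fin d)).integrable_comp this.aestronglyMeasurable).2 this
  · have hv2 : ∀ i, |v i| ≤ 2 := fun i => (hv i).trans h2.le
    have hvB : ‖v‖ ≤ d * (d * 2) + 1 := by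
      have := norm_rpow_le_sum one_pos v
      simp only [Real.rpow_one] at this
      refine this.trans (le_add_of_le_of_nonneg ?_ zero_le_one)
      gcongr
      calc ∑ i, |v i| ≤ ∑ _i : Fin d, (2 : ℝ) := Finset.sum_le_sum fun i _ => hv2 i
        _ = d * 2 := by simp
    obtain ⟨k, hk⟩ := exists_abs_rpow_le_prod hlam m hβ0 v h2.le
    refine (mul_le_mul' le_rfl (hCv v hvB k)).trans ?_
    rw [← ENNReal.ofReal_mul (coordWeight_nonneg v)]
    refine ENNReal.ofReal_le_ofReal ?_
    have hprod : coordWeight lam v * ∏ i ∈ Finset.univ.erase m, |v i| ^ γ i ≤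
        ∏ i, if |v i| ≤ 2 then |v i| ^ a i else 0 := by
      rw [coordWeight, ← Finset.mul_prod_erase _ _ (Finset.mem_univ m), mul_assoc,
        ← Finset.prod_mul_distrib, ← Finset.mul_prod_erase _ _ (Finset.mem_univ m)]
      refine mul_le_mul ?_ (Finset.prod_le_prod (fun _ _ => by positivity) fun i hi => ?_)
        (Finset.prod_nonneg fun _ _ => by positivity) ?_
      · simp only [if_pos h2.le, ha, if_true, Real.rpow_zero]
        exact Real.rpow_le_one_of_one_le_of_nonpos h1 (by linarith [hlam m])
      · have him := Finset.ne_of_mem_erase hi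
        simp only [if_pos (hv2 i), ha, if_neg him]
        rcases (abs_nonneg (v i)).eq_or_lt with h0 | h0
        · rw [← h0, Real.zero_rpow (by linarith [hlam i]), zero_mul]
          exact Real.rpow_nonneg le_rfl _
        · rw [← Real.rpow_add h0]
          exact le_of_eq (by ring_nf)
      · simp only [if_pos h2.le]
        positivity
    calc coordWeight lam v * (C * |v k| ^ β)
        ≤ coordWeight lam v * (C * (2 ^ β * ∏ i ∈ Finset.univ.erase m, |v i| ^ γ i)) := by
          have := coordWeight_nonneg (lam := lam) v
          gcongr
      _ = C * 2 ^ β * (coordWeight lam v * ∏ i ∈ Finset.univ.erase m, |v i| ^ γ i) := by ring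
      _ ≤ _ := by gcongr

end HasStarBodyCharFun

/-! ### Sign changes and exhaustion by cones -/

/-- The reflection changing the signs of the coordinates selected by `σ`. -/
noncomputable def signFlip {d : ℕ} (σ : Fin d → Bool) :
    EuclideanSpace ℝ (Fin d) ≃ₗᵢ[ℝ] EuclideanSpace ℝ (Fin d) :=
  LinearIsometryEquiv.piLpCongrRight 2 fun i =>
    if σ i then LinearIsometryEquiv.neg ℝ else LinearIsometryEquiv.refl ℝ ℝ

section signFlip

variable {d : ℕ} {lam : Fin d → ℝ}

theorem signFlip_apply (σ : Fin d → Bool) (u : EuclideanSpace ℝ (Fin d)) (i : Fin d) :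
    signFlip σ u i = if σ i then -u i else u i := by
  rw [signFlip, LinearIsometryEquiv.piLpCongrRight_apply]
  by_cases h : σ i <;> simp [h]

theorem abs_signFlip_apply (σ : Fin d → Bool) (u : EuclideanSpace ℝ (Fin d)) (i : Fin d) :
    |signFlip σ u i| = |u i| := by
  rw [signFlip_apply]
  split_ifs <;> simp

theorem coordWeight_signFlip (σ : Fin d → Bool) (u : EuclideanSpace ℝ (Fin d)) :
    coordWeight lam (signFlip σ u) = coordWeight lam u := by
  simp only [coordWeight, abs_signFlip_apply]

theorem signFlip_mem_coordCone_iff (σ : Fin d → Bool) (ε : ℝ) (u : EuclideanSpace ℝ (Fin d)) :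
    signFlip σ u ∈ coordCone d ε ↔ u ∈ coordCone d ε := by
  refine forall_congr' fun i => ?_
  rw [abs_signFlip_apply, LinearIsometryEquiv.norm_map]

/-- The sum over signs factorises, and each coordinate contributes `(exp (iθ) - 1) + (exp (-iθ) - 1)
= -2 (1 - cos θ)`. -/
theorem sum_signFlip_prod_exp_sub_one (x u : EuclideanSpace ℝ (Fin d)) :
    ∑ σ : Fin d → Bool, ∏ i, (Complex.exp ((signFlip σ u i * x i : ℝ) * Complex.I) - 1) =
      (((-2) ^ d * ∏ i, (1 - Real.cos (u i * x i)) : ℝ) : ℂ) := by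
  have h := Finset.prod_univ_sum (fun _ : Fin d => (Finset.univ : Finset Bool))
    (fun i b => Complex.exp (((if b then -u i else u i) * x i : ℝ) * Complex.I) - 1)
  rw [Fintype.piFinset_univ] at h
  simp_rw [signFlip_apply]
  rw [← h]
  have e : ∀ i, ∑ b : Bool, (Complex.exp (((if b then -u i else u i) * x i : ℝ) * Complex.I) - 1)
      = ((-2 * (1 - Real.cos (u i * x i)) : ℝ) : ℂ) := by
    intro i
    rw [Fintype.sum_bool]
    simp only [if_true, Bool.false_eq_true, if_false]
    push_cast
    rw [Complex.cos]
    ring_nf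
  simp_rw [e]
  rw [← Complex.ofReal_prod, Finset.prod_mul_distrib, Finset.prod_const, Finset.card_univ,
    Fintype.card_fin]

/-- As `ε` decreases to 0 the cones exhaust the complement of the coordinate hyperplanes; on the
hyperplanes the weight, hence `f`, vanishes. -/
theorem tendsto_setIntegral_coordCone (hlam : ∀ i, 0 < lam i)
    {f : EuclideanSpace ℝ (Fin d) → ℝ} (hf : Integrable f)
    (hf0 : ∀ u, coordWeight lam u = 0 → f u = 0) :
    Tendsto (fun ε : ℝ => ∫ u in coordCone d ε, f u) (𝓝[>] 0) (𝓝 (∫ u, f u)) := by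
  simp_rw [← integral_indicator (measurableSet_coordCone _)]
  refine tendsto_integral_filter_of_dominated_convergence (fun u => ‖f u‖) ?_ ?_ hf.norm ?_
  · exact Eventually.of_forall fun ε => (hf.indicator (measurableSet_coordCone ε)).aestronglyMeasurable
  · exact Eventually.of_forall fun ε => Eventually.of_forall fun u => norm_indicator_le_norm_self _ _
  · refine Eventually.of_forall fun u => ?_
    by_cases hu : coordWeight lam u = 0
    · have e : ∀ ε, (coordCone d ε).indicator f u = f u := fun ε => by
        by_cases hε : u ∈ coordCone d ε
        · rw [Set.indicator_of_mem hε]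
        · rw [Set.indicator_of_notMem hε, hf0 u hu]
      simp_rw [e]
      exact tendsto_const_nhds
    · refine tendsto_const_nhds.congr' ?_
      have : ∀ᶠ ε : ℝ in 𝓝[>] 0, ∀ i, ε * ‖u‖ < |u i| := by
        refine eventually_all.2 fun i => ?_
        have h0 : 0 < |u i| := abs_pos.2 (apply_ne_zero_of_coordWeight_ne_zero hlam hu i)
        have hc : Tendsto (fun ε : ℝ => ε * ‖u‖) (𝓝[>] 0) (𝓝 (0 * ‖u‖)) :=
          (Continuous.tendsto (by fun_prop) 0).mono_left nhdsWithin_le_nhds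
        rw [zero_mul] at hc
        exact hc.eventually (gt_mem_nhds h0)
      filter_upwards [this] with ε hε
      rw [Set.indicator_of_mem (show u ∈ coordCone d ε from hε)]

end signFlip

/-! ### Evaluation of the integral and conclusion -/

theorem integral_exp_neg_mul_step {α a : ℝ} (hα : 0 < α) (ha : 0 ≤ a) :
    IntegrableOn (fun s : ℝ => Real.exp (-s) * if a ≤ s ^ (1 / α) then 1 else 0) (Set.Ioi 0) ∧
    ∫ s in Set.Ioi (0 : ℝ), Real.exp (-s) * (if a ≤ s ^ (1 / α) then 1 else 0) =
      Real.exp (-a ^ α) := by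
  have e : Set.EqOn (fun s : ℝ => Real.exp (-s) * if a ≤ s ^ (1 / α) then 1 else 0)
      ((Set.Ici (a ^ α)).indicator fun s => Real.exp (-s)) (Set.Ioi 0) := by
    intro s hs
    have hs : 0 < s := hs
    have : a ≤ s ^ (1 / α) ↔ s ∈ Set.Ici (a ^ α) := by
      rw [Set.mem_Ici, one_div, Real.le_rpow_inv_iff_of_pos ha hs.le hα]
    by_cases h : s ∈ Set.Ici (a ^ α)
    · simp only [if_pos (this.2 h), Set.indicator_of_mem h, mul_one]
    · simp only [if_neg (mt this.1 h), Set.indicator_of_notMem h, mul_zero]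
  have hset : (Set.Ioi 0 ∩ Set.Ici (a ^ α) : Set ℝ) =ᵐ[volume] Set.Ioi (a ^ α) := by
    have h1 : (Set.Ioi 0 : Set ℝ) ∩ Set.Ioi (a ^ α) = Set.Ioi (a ^ α) :=
      Set.inter_eq_right.2 (Set.Ioi_subset_Ioi (Real.rpow_nonneg ha α))
    conv_rhs => rw [← h1]
    exact EventuallyEq.rfl.inter Ioi_ae_eq_Ici.symm
  constructor
  · refine IntegrableOn.congr_fun ?_ e.symm measurableSet_Ioi
    exact (integrableOn_exp_neg_Ioi 0).indicator measurableSet_Ici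
  · rw [setIntegral_congr_fun measurableSet_Ioi e, setIntegral_indicator measurableSet_Ici,
      setIntegral_congr_set hset, integral_exp_neg_Ioi]

theorem integrable_one_sub_cos_mul {p : ℝ} (hp : 0 < p) (hp2 : p < 2) (x : ℝ) :
    Integrable (fun t : ℝ => (1 - Real.cos (t * x)) * |t| ^ (-p - 1)) ∧
    ∫ t : ℝ, (1 - Real.cos (t * x)) * |t| ^ (-p - 1) = |x| ^ p * cosKernelConst p := by
  have h := lintegral_one_sub_cos_mul hp x
  have h0 : ∀ t : ℝ, 0 ≤ 1 - Real.cos (t * x) := fun t => sub_nonneg.2 (Real.cos_le_one _)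
  rw [lintegral_one_sub_cos_mul_abs_rpow hp hp2, ← ENNReal.ofReal_mul (by positivity)] at h
  simp_rw [← ENNReal.ofReal_mul (h0 _)] at h
  have hm : AEStronglyMeasurable (fun t : ℝ => (1 - Real.cos (t * x)) * |t| ^ (-p - 1)) :=
    Measurable.aestronglyMeasurable (by fun_prop)
  have hnn : ∀ t : ℝ, 0 ≤ (1 - Real.cos (t * x)) * |t| ^ (-p - 1) := fun t =>
    mul_nonneg (h0 t) (by positivity)
  refine ⟨(lintegral_ofReal_ne_top_iff_integrable hm (Eventually.of_forall hnn)).1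
    (by rw [h]; exact ENNReal.ofReal_ne_top), ?_⟩
  rw [integral_eq_lintegral_of_nonneg_ae (Eventually.of_forall hnn) hm, h, ENNReal.toReal_ofReal]
  exact mul_nonneg (by positivity) (cosKernelConst_pos hp hp2).le

namespace HasStarBodyCharFun

variable {d : ℕ} {α : ℝ} {μ : Measure (EuclideanSpace ℝ (Fin d))}
  {F : Set (EuclideanSpace ℝ (Fin d))} {lam : Fin d → ℝ}

/-- By the layer-cake formula, `exp (-‖u‖_F ^ α)` is an exponential mixture of indicators of the
dilates `s ^ (1 / α) F`, and mixed differences are linear and commute with dilations. -/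
theorem mixedDiff_exp_eq_integral (h : HasStarBodyCharFun α μ F) (hα : 0 < α)
    (u : EuclideanSpace ℝ (Fin d)) :
    mixedDiff (fun u => Real.exp (-gauge F u ^ α)) u =
      ∫ s in Set.Ioi (0 : ℝ), Real.exp (-s) *
        mixedDiff (F.indicator fun _ => (1 : ℝ)) ((s ^ (1 / α))⁻¹ • u) := by
  have e : Set.EqOn (fun s : ℝ => Real.exp (-s) *
        mixedDiff (F.indicator fun _ => (1 : ℝ)) ((s ^ (1 / α))⁻¹ • u))
      (fun s : ℝ => ∑ S : Finset (Fin d), (-1 : ℝ) ^ S.card *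
        (Real.exp (-s) * if gauge F (zeroOn S u) ≤ s ^ (1 / α) then 1 else 0)) (Set.Ioi 0) := by
    intro s hs
    have hs : 0 < s := hs
    simp only
    rw [mixedDiff_eq_sum, Finset.mul_sum]
    refine Finset.sum_congr rfl fun S _ => ?_
    rw [zeroOn_smul, h.indicator_smul (by positivity)]
    ring
  rw [setIntegral_congr_fun measurableSet_Ioi e, integral_finsetSum _ fun S _ =>
    ((integral_exp_neg_mul_step hα (gauge_nonneg _)).1.const_mul _), mixedDiff_eq_sum]
  refine Finset.sum_congr rfl fun S _ => ?_
  rw [integral_const_mul, (integral_exp_neg_mul_step hα (gauge_nonneg _)).2]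

/-- On a cone, replacing the indicator of `F` by `exp (-‖u‖_F ^ α)` multiplies the integral by
`Γ(1-λ/α)`. -/
theorem setIntegral_coordWeight_mul_mixedDiff_exp (h : HasStarBodyCharFun α μ F) (hα : 0 < α)
    (hsum : ∑ i, lam i < α)
    {R : Set (EuclideanSpace ℝ (Fin d))} (hRm : MeasurableSet R)
    (hR : ∀ s : ℝ, 0 < s → ∀ u, s • u ∈ R ↔ u ∈ R)
    (hi : IntegrableOn (mixedIntegrand lam F) R) :
    IntegrableOn (fun u => coordWeight lam u * mixedDiff (fun u => Real.exp (-gauge F u ^ α)) u) R ∧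
    ∫ u in R, coordWeight lam u * mixedDiff (fun u => Real.exp (-gauge F u ^ α)) u =
      Real.Gamma (1 - (∑ i, lam i) / α) * ∫ u in R, mixedIntegrand lam F u := by
  set L := ∑ i, lam i with hL
  set f : EuclideanSpace ℝ (Fin d) → ℝ := R.indicator (mixedIntegrand lam F) with hf
  have hfm : Measurable f := h.measurable_mixedIntegrand.indicator hRm
  have hfi : Integrable f := (integrable_indicator_iff hRm).2 hi
  -- The power `L + d` undoes the homogeneity of the weight: on `R`, integrating in `s` recovers the
  -- weight times the exponential mixed difference, while integrating in `u` leaves `exp (-s) * s ^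
  -- (-(L / α))`.
  set Φ : EuclideanSpace ℝ (Fin d) × ℝ → ℝ := fun z =>
    Real.exp (-z.2) * ((z.2 ^ (1 / α))⁻¹ ^ (L + d) * f ((z.2 ^ (1 / α))⁻¹ • z.1)) with hΦ
  have hΦm : Measurable Φ := by fun_prop
  have hconst : ∀ s : ℝ, 0 < s → (s ^ (1 / α))⁻¹ ^ (L + d) * |(((s ^ (1 / α))⁻¹) ^ d)⁻¹| =
      s ^ (-(L / α)) := by
    intro s hs
    have hc : 0 < (s ^ (1 / α))⁻¹ := by positivity
    rw [abs_of_pos (by positivity), Real.rpow_add hc, Real.rpow_natCast,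
      mul_inv_cancel_right₀ (by positivity), ← Real.rpow_neg hs.le, ← Real.rpow_mul hs.le]
    congr 1
    ring
  have hΦint : ∀ s : ℝ, 0 < s → ∀ g : EuclideanSpace ℝ (Fin d) → ℝ,
      ∫ u, Real.exp (-s) * ((s ^ (1 / α))⁻¹ ^ (L + d) * g ((s ^ (1 / α))⁻¹ • u)) =
      Real.exp (-s) * s ^ (-(L / α)) * ∫ u, g u := by
    intro s hs g
    rw [integral_const_mul, integral_const_mul, Measure.integral_comp_smul,
      finrank_euclideanSpace_fin, smul_eq_mul, ← hconst s hs]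
    ring
  have hq : L / α < 1 := (div_lt_one hα).2 hsum
  have hGi : IntegrableOn (fun s : ℝ => Real.exp (-s) * s ^ (-(L / α))) (Set.Ioi 0) := by
    have := Real.GammaIntegral_convergent (by linarith : 0 < 1 - L / α)
    simpa [sub_sub_cancel_left] using this
  have hΦi : Integrable Φ (volume.prod (volume.restrict (Set.Ioi 0))) := by
    rw [integrable_prod_iff' hΦm.aestronglyMeasurable]
    constructor
    · filter_upwards [ae_restrict_mem measurableSet_Ioi] with s hs
      have hs : 0 < s := hs
      have hc : (s ^ (1 / α))⁻¹ ≠ 0 := by positivity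
      change Integrable fun u =>
        Real.exp (-s) * ((s ^ (1 / α))⁻¹ ^ (L + d) * f ((s ^ (1 / α))⁻¹ • u))
      exact (((integrable_comp_smul_iff volume f hc).2 hfi).const_mul _).const_mul _
    · refine (hGi.mul_const (∫ u, ‖f u‖)).congr ?_
      filter_upwards [ae_restrict_mem measurableSet_Ioi] with s hs
      have hs : 0 < s := hs
      rw [← hΦint s hs fun u => ‖f u‖]
      refine integral_congr_ae (Eventually.of_forall fun u => ?_)
      simp only [hΦ]
      rw [norm_mul, norm_mul, Real.norm_of_nonneg (Real.exp_pos _).le,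
        Real.norm_of_nonneg (by positivity : 0 ≤ (s ^ (1 / α))⁻¹ ^ (L + d))]
  have hin : ∀ u, ∫ s in Set.Ioi (0 : ℝ), Φ (u, s) = R.indicator (fun u => coordWeight lam u *
      mixedDiff (fun u => Real.exp (-gauge F u ^ α)) u) u := by
    intro u
    have e : Set.EqOn (fun s => Φ (u, s)) (fun s => R.indicator (coordWeight lam) u *
        (Real.exp (-s) * mixedDiff (F.indicator fun _ => (1 : ℝ)) ((s ^ (1 / α))⁻¹ • u)))
        (Set.Ioi 0) := by
      intro s hs
      have hs : 0 < s := hs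
      have hc : 0 < (s ^ (1 / α))⁻¹ := by positivity
      simp only [hΦ, hf]
      by_cases hu : u ∈ R
      · rw [Set.indicator_of_mem hu, Set.indicator_of_mem ((hR _ hc u).2 hu), mixedIntegrand_eq,
          coordWeight_smul hc, ← hL]
        have : (s ^ (1 / α))⁻¹ ^ (L + d) * (s ^ (1 / α))⁻¹ ^ (-L - d) = 1 := by
          rw [← Real.rpow_add hc, show L + d + (-L - d) = 0 by ring, Real.rpow_zero]
        linear_combination (Real.exp (-s) * coordWeight lam u *
          mixedDiff (F.indicator fun _ => (1 : ℝ)) ((s ^ (1 / α))⁻¹ • u)) * this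
      · rw [Set.indicator_of_notMem hu, Set.indicator_of_notMem (mt (hR _ hc u).1 hu)]
        ring
    rw [setIntegral_congr_fun measurableSet_Ioi e, integral_const_mul,
      ← h.mixedDiff_exp_eq_integral hα]
    by_cases hu : u ∈ R
    · rw [Set.indicator_of_mem hu, Set.indicator_of_mem hu]
    · rw [Set.indicator_of_notMem hu, Set.indicator_of_notMem hu, zero_mul]
  constructor
  · rw [← integrable_indicator_iff hRm]
    have := hΦi.integral_prod_left
    simpa only [hin] using this
  · rw [← integral_indicator hRm]
    simp_rw [← hin]
    rw [integral_integral_swap hΦi, setIntegral_congr_fun measurableSet_Ioi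
      (fun s hs => hΦint s hs f), integral_mul_const, hf, integral_indicator hRm,
      Real.Gamma_eq_integral (by linarith)]
    simp only [sub_sub_cancel_left]

theorem ofReal_mixedDiff_exp (h : HasStarBodyCharFun α μ F) [IsProbabilityMeasure μ]
    (u : EuclideanSpace ℝ (Fin d)) :
    ((mixedDiff (fun u => Real.exp (-gauge F u ^ α)) u : ℝ) : ℂ) =
      ∫ x, ∏ i, (Complex.exp ((u i * x i : ℝ) * Complex.I) - 1) ∂μ := by
  simp_rw [← sum_exp_inner_zeroOn]
  rw [integral_finsetSum _ fun S _ => (integrable_exp_inner _).const_mul _, mixedDiff_eq_sum]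
  push_cast
  refine Finset.sum_congr rfl fun S _ => ?_
  rw [integral_const_mul]
  have := h.charFun_eq (zeroOn S u)
  rw [charFun_apply] at this
  rw [this]
  push_cast
  rfl

theorem sum_signFlip_mixedDiff_exp (h : HasStarBodyCharFun α μ F) [IsProbabilityMeasure μ]
    (u : EuclideanSpace ℝ (Fin d)) :
    ∑ σ : Fin d → Bool, mixedDiff (fun u => Real.exp (-gauge F u ^ α)) (signFlip σ u) =
      (-2) ^ d * ∫ x, ∏ i, (1 - Real.cos (u i * x i)) ∂μ := by
  rw [← Complex.ofReal_inj, Complex.ofReal_sum]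
  simp_rw [h.ofReal_mixedDiff_exp]
  rw [← integral_finsetSum, ← integral_const_mul, ← integral_complex_ofReal]
  · simp_rw [sum_signFlip_prod_exp_sub_one]
  · intro σ _
    simp_rw [← sum_exp_inner_zeroOn]
    exact integrable_finsetSum _ fun S _ => (integrable_exp_inner _).const_mul _

/-- The cone and the weight are invariant under sign changes, so all `2 ^ d` flipped integrals agree
and cancel the `2 ^ d` in `(-2) ^ d`. Integrability on the cone permits splitting the sum. -/
theorem setIntegral_coordCone_eq (h : HasStarBodyCharFun α μ F) [IsProbabilityMeasure μ]
    (hα : 0 < α) (hα2 : α ≤ 2) (hlam : ∀ i, 0 < lam i) (hsum : ∑ i, lam i < α) {ε : ℝ}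
    (hε : 0 < ε) :
    Real.Gamma (1 - (∑ i, lam i) / α) * ∫ u in coordCone d ε, mixedIntegrand lam F u =
      (-1) ^ d * ∫ u in coordCone d ε,
        coordWeight lam u * ∫ x, ∏ i, (1 - Real.cos (u i * x i)) ∂μ := by
  obtain ⟨hi, he⟩ := h.setIntegral_coordWeight_mul_mixedDiff_exp hα hsum
    (measurableSet_coordCone ε) (fun s hs u => smul_mem_coordCone_iff hs u)
    (h.integrableOn_coordCone hα2 hlam hsum hε)
  set G := mixedDiff (fun u : EuclideanSpace ℝ (Fin d) => Real.exp (-gauge F u ^ α)) with hG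
  have hpre : ∀ σ : Fin d → Bool, signFlip σ ⁻¹' coordCone d ε = coordCone d ε := fun σ =>
    Set.ext fun u => signFlip_mem_coordCone_iff σ ε u
  have hmp : ∀ σ : Fin d → Bool, MeasurePreserving (signFlip σ) volume volume := fun σ =>
    (signFlip σ).measurePreserving
  have hme : ∀ σ : Fin d → Bool, MeasurableEmbedding (signFlip σ) := fun σ =>
    (signFlip σ).toHomeomorph.measurableEmbedding
  have hflip : ∀ σ : Fin d → Bool,
      IntegrableOn (fun u => coordWeight lam u * G (signFlip σ u)) (coordCone d ε) ∧
      ∫ u in coordCone d ε, coordWeight lam u * G (signFlip σ u) =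
        ∫ u in coordCone d ε, coordWeight lam u * G u := by
    intro σ
    have h1 := (hmp σ).setIntegral_preimage_emb (hme σ) (fun u => coordWeight lam u * G u)
      (coordCone d ε)
    have h2 := ((hmp σ).integrableOn_comp_preimage (hme σ) (s := coordCone d ε)).2 hi
    rw [hpre] at h1 h2
    simp only [Function.comp_def, coordWeight_signFlip] at h1 h2
    exact ⟨h2, h1⟩
  have hG2 : ∀ u, ∑ σ : Fin d → Bool, G (signFlip σ u) =
      (-2) ^ d * ∫ x, ∏ i, (1 - Real.cos (u i * x i)) ∂μ := h.sum_signFlip_mixedDiff_exp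
  have hs := integral_finsetSum (μ := volume.restrict (coordCone d ε)) Finset.univ
    fun σ _ => (hflip σ).1
  simp_rw [← Finset.mul_sum, hG2, (hflip _).2] at hs
  rw [Finset.sum_const, Finset.card_univ, Fintype.card_fun, Fintype.card_bool, Fintype.card_fin,
    nsmul_eq_mul] at hs
  simp_rw [mul_left_comm (coordWeight lam _)] at hs
  rw [integral_const_mul, neg_pow, he] at hs
  push_cast at hs
  have h2 : (2 : ℝ) ^ d ≠ 0 := by positivity
  refine mul_left_cancel₀ h2 ?_
  rw [← hs]
  ring

/-- All factors are nonnegative, so Tonelli applies; for fixed `x` the integral over `u` is a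
product of one-dimensional kernel integrals. -/
theorem integral_coordWeight_mul_cos (h : HasStarBodyCharFun α μ F) [IsProbabilityMeasure μ]
    (hα2 : α ≤ 2) (hlam : ∀ i, 0 < lam i) (hsum : ∑ i, lam i < α) :
    Integrable (fun u : EuclideanSpace ℝ (Fin d) =>
      coordWeight lam u * ∫ x, ∏ i, (1 - Real.cos (u i * x i)) ∂μ) ∧
    ∫ u : EuclideanSpace ℝ (Fin d), coordWeight lam u * ∫ x, ∏ i, (1 - Real.cos (u i * x i)) ∂μ =
      (∏ i, cosKernelConst (lam i)) * ∫ x, ∏ i, |x i| ^ lam i ∂μ := by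
  have hlam2 : ∀ i, lam i < 2 := fun i =>
    ((Finset.single_le_sum (fun j _ => (hlam j).le) (Finset.mem_univ i)).trans_lt hsum).trans_le hα2
  have hκ : 0 ≤ ∏ i, cosKernelConst (lam i) :=
    Finset.prod_nonneg fun i _ => (cosKernelConst_pos (hlam i) (hlam2 i)).le
  have hcos0 : ∀ t : ℝ, 0 ≤ 1 - Real.cos t := fun t => sub_nonneg.2 (Real.cos_le_one t)
  have hcosm : Measurable fun z : EuclideanSpace ℝ (Fin d) × EuclideanSpace ℝ (Fin d) =>
      ∏ i, (1 - Real.cos (z.1 i * z.2 i)) := Finset.measurable_prod _ fun i _ => by fun_prop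
  have hci : ∀ u : EuclideanSpace ℝ (Fin d),
      Integrable (fun x : EuclideanSpace ℝ (Fin d) => ∏ i, (1 - Real.cos (u i * x i))) μ := by
    intro u
    refine Integrable.of_bound (hcosm.comp measurable_prodMk_left).aestronglyMeasurable (2 ^ d)
      (Eventually.of_forall fun x => ?_)
    rw [Real.norm_of_nonneg (Finset.prod_nonneg fun i _ => hcos0 _)]
    calc ∏ i, (1 - Real.cos (u i * x i)) ≤ ∏ _i : Fin d, (2 : ℝ) :=
          Finset.prod_le_prod (fun i _ => hcos0 _) fun i _ => by
            linarith [Real.neg_one_le_cos (u i * x i)]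
      _ = 2 ^ d := by simp
  have hM := h.integrable_prod_abs_rpow hα2 hlam hsum
  have hnn : ∀ u : EuclideanSpace ℝ (Fin d),
      0 ≤ coordWeight lam u * ∫ x, ∏ i, (1 - Real.cos (u i * x i)) ∂μ := fun u =>
    mul_nonneg (coordWeight_nonneg u)
      (integral_nonneg fun x => Finset.prod_nonneg fun i _ => hcos0 _)
  have hmeas : AEStronglyMeasurable (fun u : EuclideanSpace ℝ (Fin d) =>
      coordWeight lam u * ∫ x, ∏ i, (1 - Real.cos (u i * x i)) ∂μ) :=
    measurable_coordWeight.aestronglyMeasurable.mul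
      (hcosm.stronglyMeasurable.integral_prod_right').aestronglyMeasurable
  have hprod : ∀ u x : EuclideanSpace ℝ (Fin d),
      coordWeight lam u * ∏ i, (1 - Real.cos (u i * x i)) =
        ∏ i, ((1 - Real.cos (u i * x i)) * |u i| ^ (-lam i - 1)) := by
    intro u x
    rw [coordWeight, ← Finset.prod_mul_distrib]
    exact Finset.prod_congr rfl fun i _ => mul_comm _ _
  have hinner : ∀ x : EuclideanSpace ℝ (Fin d),
      ∫⁻ u : EuclideanSpace ℝ (Fin d),
        ENNReal.ofReal (coordWeight lam u * ∏ i, (1 - Real.cos (u i * x i))) =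
      ENNReal.ofReal ((∏ i, cosKernelConst (lam i)) * ∏ i, |x i| ^ lam i) := by
    intro x
    set q : (Fin d → ℝ) → ℝ := fun t => ∏ i, ((1 - Real.cos (t i * x i)) * |t i| ^ (-lam i - 1))
      with hq
    have hqi : Integrable q := Integrable.fintype_prod (μ := fun _ : Fin d => (volume : Measure ℝ))
      fun i => (integrable_one_sub_cos_mul (hlam i) (hlam2 i) (x i)).1
    have hmp := PiLp.volume_preserving_ofLp (Fin d)
    have hqi' : Integrable (fun u : EuclideanSpace ℝ (Fin d) => q u.ofLp) :=
      (hmp.integrable_comp hqi.aestronglyMeasurable).2 hqi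
    have hqv : ∫ u : EuclideanSpace ℝ (Fin d), q u.ofLp = ∫ t, q t :=
      hmp.integral_comp (MeasurableEquiv.toLp 2 (Fin d → ℝ)).symm.measurableEmbedding q
    simp_rw [hprod]
    rw [← ofReal_integral_eq_lintegral_ofReal hqi' (Eventually.of_forall fun u =>
      Finset.prod_nonneg fun i _ => mul_nonneg (hcos0 _) (by positivity)), hqv, hq,
      integral_fintype_prod_volume_eq_prod
        fun i (t : ℝ) => (1 - Real.cos (t * x i)) * |t| ^ (-lam i - 1),
      ← Finset.prod_mul_distrib]
    congr 1
    refine Finset.prod_congr rfl fun i _ => ?_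
    rw [(integrable_one_sub_cos_mul (hlam i) (hlam2 i) (x i)).2, mul_comm]
  have key : ∫⁻ u : EuclideanSpace ℝ (Fin d), ENNReal.ofReal
      (coordWeight lam u * ∫ x, ∏ i, (1 - Real.cos (u i * x i)) ∂μ) =
      ENNReal.ofReal ((∏ i, cosKernelConst (lam i)) * ∫ x, ∏ i, |x i| ^ lam i ∂μ) := by
    have h1 : ∀ u : EuclideanSpace ℝ (Fin d), ENNReal.ofReal
        (coordWeight lam u * ∫ x, ∏ i, (1 - Real.cos (u i * x i)) ∂μ) =
        ∫⁻ x, ENNReal.ofReal (coordWeight lam u * ∏ i, (1 - Real.cos (u i * x i))) ∂μ := by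
      intro u
      rw [← integral_const_mul, ofReal_integral_eq_lintegral_ofReal ((hci u).const_mul _)
        (Eventually.of_forall fun x => mul_nonneg (coordWeight_nonneg u)
          (Finset.prod_nonneg fun i _ => hcos0 _))]
    simp_rw [h1]
    rw [lintegral_lintegral_swap]
    · simp_rw [hinner]
      rw [← integral_const_mul, ofReal_integral_eq_lintegral_ofReal (hM.const_mul _)
        (Eventually.of_forall fun x => mul_nonneg hκ (Finset.prod_nonneg fun i _ => by positivity))]
    · exact ((measurable_coordWeight.comp measurable_fst).mul hcosm).ennreal_ofReal.aemeasurable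
  refine ⟨(lintegral_ofReal_ne_top_iff_integrable hmeas (Eventually.of_forall hnn)).1
    (by rw [key]; exact ENNReal.ofReal_ne_top), ?_⟩
  rw [integral_eq_lintegral_of_nonneg_ae (Eventually.of_forall hnn) hmeas, key,
    ENNReal.toReal_ofReal (mul_nonneg hκ (integral_nonneg fun x =>
      Finset.prod_nonneg fun i _ => by positivity))]

theorem mixedConst_mul (hlam : ∀ i, 0 < lam i) (hlam2 : ∀ i, lam i < 2) :
    mixedConst α lam * ((-1) ^ d * ∏ i, cosKernelConst (lam i)) =
      Real.Gamma (1 - (∑ i, lam i) / α) := by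
  have h1 : ∀ i, lam i * Real.Gamma ((lam i + 1) / 2) / Real.Gamma (1 - lam i / 2) *
      cosKernelConst (lam i) = 2 ^ (1 - lam i) * √Real.pi := by
    intro i
    have := hlam i
    have := Real.Gamma_pos_of_pos (by linarith [hlam2 i] : 0 < 1 - lam i / 2)
    have := Real.Gamma_pos_of_pos (by linarith : 0 < (lam i + 1) / 2)
    unfold cosKernelConst
    generalize Real.Gamma (1 - lam i / 2) = a at *
    field_simp
  have h2 : (∏ i, (lam i * Real.Gamma ((lam i + 1) / 2) / Real.Gamma (1 - lam i / 2))) *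
      ∏ i, cosKernelConst (lam i) = 2 ^ (d - ∑ i, lam i) * Real.pi ^ ((d : ℝ) / 2) := by
    rw [← Finset.prod_mul_distrib, Finset.prod_congr rfl fun i _ => h1 i, Finset.prod_mul_distrib,
      ← Real.rpow_sum_of_pos two_pos, Finset.prod_const, Finset.card_univ, Fintype.card_fin,
      Real.sqrt_eq_rpow, ← Real.rpow_mul_natCast Real.pi_pos.le]
    congr 2
    · simp
    · ring
  have h3 : (2 : ℝ) ^ ((∑ i, lam i) - d) * 2 ^ (d - ∑ i, lam i) = 1 := by
    rw [← Real.rpow_add two_pos, sub_add_sub_cancel, sub_self, Real.rpow_zero]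
  have h4 : ((-1 : ℝ) ^ d) * (-1) ^ d = 1 := by
    rw [← mul_pow]; simp
  have hpi : Real.pi ^ ((d : ℝ) / 2) ≠ 0 := (Real.rpow_pos_of_pos Real.pi_pos _).ne'
  unfold mixedConst
  set A := ∏ i, (lam i * Real.Gamma ((lam i + 1) / 2) / Real.Gamma (1 - lam i / 2))
  calc _ = ((2 : ℝ) ^ ((∑ i, lam i) - d) / Real.pi ^ ((d : ℝ) / 2)) *
        ((-1 : ℝ) ^ d * (-1) ^ d) * Real.Gamma (1 - (∑ i, lam i) / α) *
        (A * ∏ i, cosKernelConst (lam i)) := by ring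
    _ = _ := by
      rw [h2, h4]
      generalize Real.Gamma (1 - (∑ i, lam i) / α) = g
      field_simp
      linear_combination g * h3

/-- The cone integrals of the mixed integrand are a fixed multiple of those of the cosine integrand,
which is integrable on the whole space; hence their limit exists even when the mixed integrand is
not integrable. -/
theorem exists_tendsto_coordCone (h : HasStarBodyCharFun α μ F) [IsProbabilityMeasure μ]
    (hα : 0 < α) (hα2 : α ≤ 2) (hlam : ∀ i, 0 < lam i) (hsum : ∑ i, lam i < α) :
    ∃ I : ℝ, Tendsto (fun ε : ℝ => ∫ u in coordCone d ε, mixedIntegrand lam F u) (𝓝[>] 0) (𝓝 I) ∧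
      ∫ x, ∏ i, |x i| ^ lam i ∂μ = mixedConst α lam * I := by
  have hlam2 : ∀ i, lam i < 2 := fun i =>
    ((Finset.single_le_sum (fun j _ => (hlam j).le) (Finset.mem_univ i)).trans_lt hsum).trans_le hα2
  have hΓ : 0 < Real.Gamma (1 - (∑ i, lam i) / α) :=
    Real.Gamma_pos_of_pos (by rw [sub_pos, div_lt_one hα]; exact hsum)
  obtain ⟨hi, he⟩ := h.integral_coordWeight_mul_cos hα2 hlam hsum
  have ht := (tendsto_setIntegral_coordCone hlam hi fun u hu => by rw [hu, zero_mul]).const_mul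
    ((-1) ^ d / Real.Gamma (1 - (∑ i, lam i) / α))
  rw [he] at ht
  refine ⟨_, ht.congr' ?_, ?_⟩
  · filter_upwards [self_mem_nhdsWithin] with ε hε
    rw [div_mul_eq_mul_div, ← h.setIntegral_coordCone_eq hα hα2 hlam hsum hε,
      mul_div_cancel_left₀ _ hΓ.ne']
  · have := mixedConst_mul (α := α) hlam hlam2
    rw [div_mul_eq_mul_div, ← mul_assoc, ← mul_div_assoc, ← mul_assoc, this,
      mul_div_cancel_left₀ _ hΓ.ne']

end HasStarBodyCharFun

theorem IsAssociatedStarBody.hasStarBodyCharFun {d : ℕ} {Ω : Type*} [MeasurableSpace Ω]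
    {P : Measure Ω} {α : ℝ} {ξ : Ω → EuclideanSpace ℝ (Fin d)}
    {F : Set (EuclideanSpace ℝ (Fin d))} (hF : IsAssociatedStarBody α ξ P F) :
    HasStarBodyCharFun α (P.map ξ) F :=
  ⟨hF.isStarBody, hF.neg_mem, hF.charFun_eq⟩

theorem mainTheorem4 {d : ℕ} {Ω : Type*} [MeasurableSpace Ω] (P : Measure Ω)
    [IsProbabilityMeasure P] (α : ℝ) (hα0 : 0 < α) (hα2 : α ≤ 2)
    (ξ : Ω → EuclideanSpace ℝ (Fin d)) (hξ : IsSymmetricStable α ξ P)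
    (lam : Fin d → ℝ) (hlam : ∀ i, 0 < lam i) (hsum : ∑ i, lam i < α) :
    -- the associated star body is well defined, and the mixed moment is finite
    (∃! F : Set (EuclideanSpace ℝ (Fin d)), IsAssociatedStarBody α ξ P F) ∧
    Integrable (fun ω => ∏ i, |ξ ω i| ^ lam i) P ∧
    ∀ F : Set (EuclideanSpace ℝ (Fin d)), IsAssociatedStarBody α ξ P F →
      -- the formula, with the integral over the space as a limit of convergent integrals
      (∀ ε : ℝ, 0 < ε → IntegrableOn (mixedIntegrand lam F) (coordCone d ε) volume) ∧
      (∃ I : ℝ,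
        Tendsto (fun ε : ℝ => ∫ u in coordCone d ε, mixedIntegrand lam F u) (𝓝[>] 0) (𝓝 I) ∧
        ∫ ω, ∏ i, |ξ ω i| ^ lam i ∂P = mixedConst α lam * I) ∧
      -- the formula with the Lebesgue integral, whenever that integral exists
      (Integrable (mixedIntegrand lam F) volume →
        ∫ ω, ∏ i, |ξ ω i| ^ lam i ∂P = mixedConst α lam * ∫ u, mixedIntegrand lam F u) ∧
      -- a condition under which it exists (it always holds if `α ≤ 1` or `d = 1`)
      ((∀ k, (∑ i, lam i) - lam k < 1) → Integrable (mixedIntegrand lam F) volume) := by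
  have hprob : IsProbabilityMeasure (P.map ξ) := Measure.isProbabilityMeasure_map hξ.aemeasurable
  have hex := hξ.existsUnique_starBody hα0
  have hmeas : AEStronglyMeasurable
      (fun x : EuclideanSpace ℝ (Fin d) => ∏ i, |x i| ^ lam i) (P.map ξ) :=
    (Finset.measurable_prod _ fun i _ => by fun_prop).aestronglyMeasurable
  have hmap : ∫ ω, ∏ i, |ξ ω i| ^ lam i ∂P =
      ∫ x, ∏ i, |x i| ^ lam i ∂(P.map ξ) := (integral_map hξ.aemeasurable hmeas).symm
  refine ⟨hex, ?_, fun F hF => ?_⟩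
  · obtain ⟨F, hF, -⟩ := hex
    exact (integrable_map_measure hmeas hξ.aemeasurable).1
      (hF.hasStarBodyCharFun.integrable_prod_abs_rpow hα2 hlam hsum)
  have h := hF.hasStarBodyCharFun
  obtain ⟨I, hI, hIeq⟩ := h.exists_tendsto_coordCone hα0 hα2 hlam hsum
  rw [hmap]
  refine ⟨fun ε hε => h.integrableOn_coordCone hα2 hlam hsum hε, ⟨I, hI, hIeq⟩, fun hint => ?_,
    fun hk => h.integrable_mixedIntegrand hα2 hlam hsum hk⟩
  rw [hIeq, tendsto_nhds_unique hI (tendsto_setIntegral_coordCone hlam hint fun u hu => by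
    rw [mixedIntegrand_eq, hu, zero_mul])]
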